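/- Let $f_1,f_2,\dots$ be i.i.d. (jointly measurable, not necessarily centred) second-order processes on $[0,1]$ with $\mathbb E\|f_1\|_{L^2}^4<\infty$, let $K(s,t)=\operatorname{Cov}(f_1(s),f_1(t))=\sum_{p\ge1}\lambda_p\phi_p(s)\phi_p(t)$ be the eigen-decomposition of their covariance function ($\lambda_1\ge\lambda_2\ge\cdots$, $(\phi_p)$ orthonormal in $L^2([0,1])$), and let $(a_p)$ be a real sequence with $\sum_p a_p^2<\infty$. For $g\in L^2([0,1])$ and a real sequence $(b_p)$ put $$\|g\|_{mod}^2=\sum_{p\ge1}\frac{\langle g,\phi_p\rangle^2}{\lambda_p}a_p^2\in[0,\infty],\qquad \|g\|_b^2=\sum_{p\ge1}\frac{\langle g,\phi_p\rangle^2}{\lambda_p}b_p^2 ,$$ and let $F(x)=\mathbb P(\|f_1\|_{mod}^2\le x)$, $x \in [0,\infty]$. Assume: 1. there are $\beta>1$ and $C,C_1,C_2>0$ with $C_1p^{-\beta}\ge\lambda_p\ge C_2p^{-\beta}$ and $\lambda_p-\lambda_{p+1}\ge C\,p^{-(\beta+1)}$ for all $p\ge1$; 2. $\sum_pb_p^2<\infty$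 and, for some $\alpha>0$, $a_p\le b_p\,p^{-\alpha}$ for all large $p$; 3. $\|f_1\|_b$ is almost surely finite and sub-Gaussian: for some $\sigma>0$, $\mathbb E\exp\{t(\|f_1\|_b-\mathbb E\|f_1\|_b)\}\le\exp(\sigma^2t^2/2)$ for all $t\in\mathbb R$. Let $\delta_n\to0$ be thresholds such that, for some constant $c>0$, $\delta_n\ge c\,(\sqrt n/\log n)^{-\beta/(2\beta+1)}$ for all large $n$. For each $n$ let $\hat K_n(s,t)=\frac1n\sum_{i=1}^n(f_i(s)-\bar f(s))(f_i(t)-\bar f(t))=\sum_{p=1}^n\hat\lambda_{p,n}\hat\phi_{p,n}(s)\hat\phi_{p,n}(t)$, with $\bar f=\frac1n\sum_{i=1}^n f_i$, be any eigen-decomposition of the empirical covariance kernel ($\hat\lambda_{1,n}\ge\dots\ge\hat\lambda_{n,n}\ge0$, $\hat\phi_{p,n}$ orthonormal), and put $$\|g\|_{\widehat{mod}}^2=\sum_{p=1}^{C_n}\frac{\langle g,\hat\phi_{p,n}\rangle^2}{\hat\lambda_{p,n}}a_p^2,\qquad C_n=\min(M_n,n),$$ where $M_n$ is the largest $m$ with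 $\hat\lambda_{m,n}\ge\delta_n$, or alternatively the largest $m$ with $\lambda_m\ge\delta_n$ ($M_n=0$ if there is none). Let $f_{obs}\in L^2([0,1])$ be such that $F$ has no jump at $\|f_{obs}\|_{mod}^2$, that is, $\mathbb P(\|f_1\|_{mod}=\|f_{obs}\|_{mod})=0$. Then, for either choice of $M_n$, $$\frac1n\sum_{i=1}^n\mathbf 1\{\|f_i\|_{\widehat{mod}}\ge\|f_{obs}\|_{\widehat{mod}}\}\longrightarrow 1-F\big(\|f_{obs}\|_{mod}^2\big)\quad\text{in probability as }n\to\infty .$$ -/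

import Mathlib

open MeasureTheory ProbabilityTheory Filter Topology
open scoped unitInterval ENNReal NNReal

namespace ModDepth

noncomputable section

/-- The coefficient `⟨g, φ⟩ = ∫₀¹ g(t) φ(t) dt` (classical inner product of `L²([0,1])`). -/
def coeff (g φ : I → ℝ) : ℝ := ∫ t, g t * φ t

/-- The covariance function
`K(s,t) = E[(f(s) - E f(s)) (f(t) - E f(t))]` of a process `f` on `[0,1]`. -/
def covKernel {Ω : Type*} [MeasurableSpace Ω] (μ : Measure Ω) (f : Ω → I → ℝ) (s t : I) : ℝ :=
  cov[fun ω ↦ f ω s, fun ω ↦ f ω t; μ]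

/-- The sample mean function `(1/n) ∑ᵢ xᵢ(t)` of `n` functions. -/
def sampleMean {n : ℕ} (x : Fin n → I → ℝ) (t : I) : ℝ :=
  (1 / (n : ℝ)) * ∑ i, x i t

/-- The empirical covariance kernel `(1/n) ∑ᵢ (xᵢ(s) - x̄(s)) (xᵢ(t) - x̄(t))`
of `n` functions. -/
def empKernel {n : ℕ} (x : Fin n → I → ℝ) (s t : I) : ℝ :=
  (1 / (n : ℝ)) * ∑ i, (x i s - sampleMean x s) * (x i t - sampleMean x t)

/-- `(lam p, phi p)`, `p : ι`, is an eigen-decomposition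
`K(s,t) = ∑ₚ lam p * phi p s * phi p t` of the kernel `K`: the eigenfunctions are orthonormal in
`L²([0,1])` and the eigenvalues are non-negative and listed in non-increasing order. It is used with
`ι = ℕ` for a covariance kernel and with `ι = Fin n` for the empirical covariance kernel of
`n` functions. (Identities between functions are meant up to null sets, as in `L²`.) -/
structure IsEigenDecomposition {ι : Type*} [LinearOrder ι] (K : I → I → ℝ)
    (lam : ι → ℝ) (phi : ι → I → ℝ) : Prop where
  memLp : ∀ p, MemLp (phi p) 2
  orthonormal : ∀ p q, coeff (phi p) (phi q) = if p = q then 1 else 0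
  nonneg : ∀ p, 0 ≤ lam p
  antitone : Antitone lam
  eigen : ∀ p, ∀ᵐ t : I, ∫ s, K s t * phi p s = lam p * phi p t
  expansion : ∀ᵐ x : I × I, HasSum (fun p ↦ lam p * phi p x.1 * phi p x.2) (K x.1 x.2)

/-- The squared weighted norm `∑ₚ ⟨g, φₚ⟩² / λₚ * wₚ²`, with value in `[0, ∞]`. The weights
`w = a` give `‖g‖²_mod`, the weights `w = b` give `‖g‖²_b`. Sequences are indexed from `0`, so that
`lam p`, `phi p`, `w p` are the terms of index `p + 1` of sequences indexed from `1`. -/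
def normSq (lam : ℕ → ℝ) (phi : ℕ → I → ℝ) (w : ℕ → ℝ) (g : I → ℝ) : ℝ≥0∞ :=
  ∑' p, ENNReal.ofReal (coeff g (phi p) ^ 2 / lam p * w p ^ 2)

/-- The (unsquared) weighted norm as a real number; meaningful where `normSq` is finite. -/
def weightedNorm (lam : ℕ → ℝ) (phi : ℕ → I → ℝ) (w : ℕ → ℝ) (g : I → ℝ) : ℝ :=
  Real.sqrt (normSq lam phi w g).toReal

/-- The distribution function `F(x) = P(‖f‖²_mod ≤ x)` of the squared modified norm of `f`
(with `F(∞) = 1`). -/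
def modCdf {Ω : Type*} [MeasurableSpace Ω] (μ : Measure Ω) (f : Ω → I → ℝ)
    (lam : ℕ → ℝ) (phi : ℕ → I → ℝ) (a : ℕ → ℝ) (x : ℝ≥0∞) : ℝ :=
  μ.real {ω | normSq lam phi a (f ω) ≤ x}

/-- The sample version `‖g‖_{mod-hat}` of the modified norm: the square root of
`∑ ⟨g, φ̂ₚ⟩² / λ̂ₚ * aₚ²`, summed over those `p` among the first `n` for which
`cut p` is at least the threshold `δ`. For a non-increasing `cut` these are the first
`min Mₙ n` indices, where `Mₙ` is the last index with `cut ≥ δ`. -/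
def hatNorm {n : ℕ} (cut : Fin n → ℝ) (δ : ℝ) (lamHat : Fin n → ℝ) (phiHat : Fin n → I → ℝ)
    (a : ℕ → ℝ) (g : I → ℝ) : ℝ :=
  Real.sqrt (∑ p with δ ≤ cut p, coeff g (phiHat p) ^ 2 / lamHat p * a p ^ 2)

/-- The sample average `(1/n) ∑ᵢ 1{‖xᵢ‖_{mod-hat} ≥ ‖fobs‖_{mod-hat}}`. -/
def depthEstimator {n : ℕ} (cut : Fin n → ℝ) (δ : ℝ) (lamHat : Fin n → ℝ)
    (phiHat : Fin n → I → ℝ) (a : ℕ → ℝ) (x : Fin n → I → ℝ) (fobs : I → ℝ) : ℝ :=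
  (1 / (n : ℝ)) * ∑ i,
    if hatNorm cut δ lamHat phiHat a fobs ≤ hatNorm cut δ lamHat phiHat a (x i) then 1 else 0

/-- Polynomial decay and spacing of the eigenvalues:
`C₁ p^{-β} ≥ λₚ ≥ C₂ p^{-β}` and `λₚ - λₚ₊₁ ≥ C p^{-(β+1)}` for all `p ≥ 1`. -/
def EigenvalueDecay (lam : ℕ → ℝ) (β : ℝ) : Prop :=
  1 < β ∧ ∃ C C₁ C₂ : ℝ, 0 < C ∧ 0 < C₁ ∧ 0 < C₂ ∧ ∀ p : ℕ,
    lam p ≤ C₁ * ((p : ℝ) + 1) ^ (-β) ∧ C₂ * ((p : ℝ) + 1) ^ (-β) ≤ lam p ∧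
    C * ((p : ℝ) + 1) ^ (-(β + 1)) ≤ lam p - lam (p + 1)

/-- The weights `a` are dominated by square-summable weights `b`:
`∑ bₚ² < ∞` and `aₚ ≤ bₚ p^{-α}` for all large `p`, for some `α > 0`. -/
def WeightDomination (a b : ℕ → ℝ) : Prop :=
  Summable (fun p ↦ b p ^ 2) ∧
    ∃ α : ℝ, 0 < α ∧ ∀ᶠ p : ℕ in atTop, a p ≤ b p * ((p : ℝ) + 1) ^ (-α)

/-- The norm `‖f‖_b` is (almost surely finite and) sub-Gaussian:
`E exp(t (‖f‖_b - E‖f‖_b)) ≤ exp(τ² t² / 2)` for all real `t`, for some `τ > 0`. -/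
def SubGaussianNorm {Ω : Type*} [MeasurableSpace Ω] (μ : Measure Ω) (f : Ω → I → ℝ)
    (lam : ℕ → ℝ) (phi : ℕ → I → ℝ) (b : ℕ → ℝ) : Prop :=
  (∀ᵐ ω ∂μ, normSq lam phi b (f ω) ≠ ∞) ∧
    ∃ τ : ℝ≥0, 0 < τ ∧
      HasSubgaussianMGF
        (fun ω ↦ weightedNorm lam phi b (f ω) - ∫ ω', weightedNorm lam phi b (f ω') ∂μ) (τ ^ 2) μ

end

end ModDepth

/-! Write `R n = √n / log n` and `D = 1 / R n`. The argument combines a deterministic perturbation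
bound, valid once the empirical kernel is within `D` of the covariance kernel in `L²([0,1]²)`, with
the law of large numbers for events that no longer involve the empirical eigenpairs.

Perturbation: the Hilbert–Schmidt distance bounds the operator distance, so Weyl's inequality moves
each eigenvalue by at most `D`, and the spectral gap of order `p^{-(β+1)}` moves the `p`-th
eigenvector, up to sign, by at most a constant times `D p^{β+1}`. Dividing a squared coefficient by
`λₚ ~ p^{-β}` requires this displacement to be small compared with `p^{-β/2}`, that is, `D
p^{(3β+2)/2}` to be small (`SpectralForm.exists_tolerance`). The threshold retains only `p` up to
order `R^{1/(2β+1)}`, for which this quantity is of order `R^{-β/(4β+2)}` and tends to zero, while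
every fixed index is eventually retained (`eventually_selection`).

Bracketing: each retained term then has relative error `η` and additive error `η ‖g‖²`. The additive
errors are summable against `aₚ²`, so the estimated squared norm of every `g` lies between two fixed
functions of its true coefficients and of `‖g‖²` (`exists_hatNormSq_bounds`). Consequently each
indicator in the estimator lies between indicators of two events in the statistics of `fᵢ` alone.

Limit: for a fixed bracket the averages converge by the law of large numbers. As the bracket
tightens, both events tend to `‖f‖_mod ≥ ‖f_obs‖_mod` off the set where the two norms agree, which
is null by assumption. Infinite norms need no separate treatment, since the comparison takes place
in `[0, ∞]`.

Two probabilistic inputs remain. Fourth moments and Markov's inequality give the rate `D`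
(`tendsto_measure_empKernel_far`). Moreover, independence and equality in law concern the product
σ-algebra on `I → ℝ`, for which path integrals need not be measurable; Monte Carlo sampling at fixed
points supplies measurable versions (`exists_measurable_functional`). -/

namespace ModDepth

/-! ### Spectral perturbation in a Hilbert space. -/

section Hilbert

variable {H : Type*} [NormedAddCommGroup H] [InnerProductSpace ℝ H]

/-- `T u v = ∑ₚ lam p ⟨e p, u⟩ ⟨e p, v⟩` with `e` orthonormal and `lam` non-negative and
non-increasing. -/
structure SpectralForm {ι : Type*} [LinearOrder ι] (lam : ι → ℝ) (e : ι → H) (T : H → H → ℝ) :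
    Prop where
  orthonormal : Orthonormal ℝ e
  nonneg : ∀ p, 0 ≤ lam p
  antitone : Antitone lam
  hasSum : ∀ u v, HasSum (fun p ↦ lam p * (inner ℝ (e p) u * inner ℝ (e p) v)) (T u v)

namespace SpectralForm

variable {ι κ : Type*} [LinearOrder ι] [LinearOrder κ] {lam : ι → ℝ} {e : ι → H} {T : H → H → ℝ}
  {mu : κ → ℝ} {d : κ → H} {S : H → H → ℝ}

lemma apply_eigenvector (h : SpectralForm lam e T) (p : ι) (v : H) :
    T (e p) v = lam p * inner ℝ (e p) v := by
  refine (h.hasSum (e p) v).unique ?_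
  have := hasSum_ite_eq p (lam p * inner ℝ (e p) v)
  refine this.congr_fun fun q ↦ ?_
  rw [orthonormal_iff_ite.1 h.orthonormal q p]
  split_ifs with hq
  · subst hq; simp
  · simp

lemma sum_sq_le (h : SpectralForm lam e T) (s : Finset ι) (u : H) :
    ∑ p ∈ s, inner ℝ (e p) u ^ 2 ≤ ‖u‖ ^ 2 := by
  simpa using h.orthonormal.sum_inner_products_le u (s := s)

/-- The lower half of the min-max principle: on the span of the leading eigenvectors every
eigenvalue involved is at least `lam p`. -/
lemma le_of_sum_Iic [LocallyFiniteOrderBot ι] (h : SpectralForm lam e T) (p : ι) (c : ι → ℝ) :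
    lam p * ‖∑ q ∈ Finset.Iic p, c q • e q‖ ^ 2 ≤
      T (∑ q ∈ Finset.Iic p, c q • e q) (∑ q ∈ Finset.Iic p, c q • e q) := by
  set u := ∑ q ∈ Finset.Iic p, c q • e q with hu
  have hc : ∀ q ∈ Finset.Iic p, inner ℝ (e q) u = c q := fun q hq ↦
    h.orthonormal.inner_right_sum c hq
  have hn : ‖u‖ ^ 2 = ∑ q ∈ Finset.Iic p, c q ^ 2 := by
    rw [← real_inner_self_eq_norm_sq]
    nth_rewrite 1 [hu]
    rw [sum_inner]
    refine Finset.sum_congr rfl fun q hq ↦ ?_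
    rw [real_inner_smul_left, hc q hq, sq]
  calc lam p * ‖u‖ ^ 2 = ∑ q ∈ Finset.Iic p, lam p * c q ^ 2 := by rw [hn, Finset.mul_sum]
    _ ≤ ∑ q ∈ Finset.Iic p, lam q * (inner ℝ (e q) u * inner ℝ (e q) u) := by
        refine Finset.sum_le_sum fun q hq ↦ ?_
        rw [hc q hq, ← sq]
        exact mul_le_mul_of_nonneg_right (h.antitone (Finset.mem_Iic.1 hq)) (sq_nonneg _)
    _ ≤ T u u := sum_le_hasSum _ (fun q _ ↦ mul_nonneg (h.nonneg q) (mul_self_nonneg _))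
        (h.hasSum u u)

/-- The upper half of the min-max principle, by Bessel's inequality; `e` need not be complete. -/
lemma apply_le_of_inner_eq_zero (h : SpectralForm lam e T) (p : ι) {u : H}
    (hu : ∀ q < p, inner ℝ (e q) u = 0) : T u u ≤ lam p * ‖u‖ ^ 2 := by
  refine hasSum_le_of_sum_le (h.hasSum u u) fun s ↦ ?_
  calc ∑ q ∈ s, lam q * (inner ℝ (e q) u * inner ℝ (e q) u)
      ≤ ∑ q ∈ s, lam p * inner ℝ (e q) u ^ 2 := by
        refine Finset.sum_le_sum fun q _ ↦ ?_
        rcases lt_or_ge q p with hq | hq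
        · simp [hu q hq]
        · rw [← sq]
          exact mul_le_mul_of_nonneg_right (h.antitone hq) (sq_nonneg _)
    _ ≤ lam p * ‖u‖ ^ 2 := by
        rw [← Finset.mul_sum]
        exact mul_le_mul_of_nonneg_left (h.sum_sq_le s u) (h.nonneg p)

/-- One half of Weyl's inequality. -/
lemma eigenvalue_le_add [LocallyFiniteOrderBot ι] [LocallyFiniteOrderBot κ]
    (h : SpectralForm lam e T) (h' : SpectralForm mu d S) {D : ℝ}
    (hD : ∀ u, T u u - S u u ≤ D * ‖u‖ ^ 2) {p : ι} {q : κ}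
    (hpq : (Finset.Iio q).card < (Finset.Iic p).card) : lam p ≤ mu q + D := by
  -- Dimension count: the span of the `e i`, `i ≤ p`, has larger dimension than the number of
  -- constraints `⟨d r, u⟩ = 0`, `r < q`, so some nonzero `u` satisfies all of them. Both halves of
  -- min-max apply to this `u`.
  let L : (Finset.Iic p → ℝ) →ₗ[ℝ] (Finset.Iio q → ℝ) :=
    { toFun := fun c r ↦ inner ℝ (d r) (∑ i, c i • e i)
      map_add' := fun c c' ↦ by
        ext r; simp [add_smul, Finset.sum_add_distrib, inner_add_right]
      map_smul' := fun c c' ↦ by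
        ext r; simp [mul_smul, ← Finset.smul_sum, real_inner_smul_right] }
  have hker : L.ker ≠ ⊥ := LinearMap.ker_ne_bot_of_finrank_lt (by simpa using hpq)
  obtain ⟨c, hcL, hc0⟩ := (Submodule.ne_bot_iff _).1 hker
  have hinj : ∑ i, c i • e i ≠ 0 := fun h0 ↦ hc0 <| by
    have hli : LinearIndependent ℝ fun i : Finset.Iic p ↦ e i :=
      h.orthonormal.linearIndependent.comp _ Subtype.val_injective
    ext i
    exact Fintype.linearIndependent_iff.1 hli c h0 i
  classical
  let c' : ι → ℝ := fun i ↦ if hi : i ∈ Finset.Iic p then c ⟨i, hi⟩ else 0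
  have hsum : ∑ i, c i • e i = ∑ i ∈ Finset.Iic p, c' i • e i := by
    rw [← Finset.sum_coe_sort (Finset.Iic p) fun i ↦ c' i • e i]
    refine Finset.sum_congr rfl fun i _ ↦ ?_
    have : c' i = c i := by simp only [c', dif_pos i.2]
    rw [this]
  set u := ∑ i ∈ Finset.Iic p, c' i • e i with hu
  have h1 := h.le_of_sum_Iic p c'
  have h2 : S u u ≤ mu q * ‖u‖ ^ 2 := h'.apply_le_of_inner_eq_zero q fun r hr ↦ by
    have : inner ℝ (d r) (∑ i, c i • e i) = 0 :=
      congrFun (LinearMap.mem_ker.1 hcL) ⟨r, Finset.mem_Iio.2 hr⟩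
    rwa [hsum] at this
  have hpos : 0 < ‖u‖ ^ 2 := by
    rw [hsum] at hinj
    positivity
  have h3 := hD u
  rw [← hu] at h1
  refine le_of_mul_le_mul_right ?_ hpos
  linarith

/-- Eigenvector perturbation: a unit vector that nearly satisfies the eigenvalue equation of `T`
is close to an eigenvector. -/
lemma exists_sign_norm_sub_sq_le {lam : ℕ → ℝ} {e : ℕ → H} (h : SpectralForm lam e T) {x : H}
    (hx : ‖x‖ = 1) {l D g : ℝ} (hD : ∀ v, l * inner ℝ x v - T x v ≤ D * ‖v‖) (hg : 0 < g) {p : ℕ}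
    (hlow : g ≤ l - lam (p + 1)) (hup : ∀ q < p, g ≤ lam q - l) :
    ∃ s : ℝ, s ^ 2 = 1 ∧ ‖x - s • e p‖ ^ 2 ≤ 2 * (D / g) ^ 2 := by
  set c : ℕ → ℝ := fun q ↦ inner ℝ (e q) x with hc
  have horth : ∀ q r, inner ℝ (e q) (e r) = if q = r then (1 : ℝ) else 0 :=
    orthonormal_iff_ite.1 h.orthonormal
  set w : H := ∑ q ∈ Finset.range p, c q • e q with hw
  have hew : ∀ r, inner ℝ (e r) w = if r < p then c r else 0 := fun r ↦ by
    rw [hw, inner_sum]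
    simp_rw [real_inner_smul_right, horth]
    simp
  set A : ℝ := ∑ q ∈ Finset.range p, c q ^ 2 with hA
  have hxw : inner ℝ x w = A := by
    rw [hw, inner_sum]
    refine Finset.sum_congr rfl fun q _ ↦ ?_
    rw [real_inner_smul_right, real_inner_comm, sq]
  have hww : inner ℝ w w = A := by
    nth_rewrite 1 [hw]
    rw [sum_inner]
    refine Finset.sum_congr rfl fun q hq ↦ ?_
    rw [real_inner_smul_left, hew, if_pos (Finset.mem_range.1 hq), sq]
  have hxx : inner ℝ x x = (1 : ℝ) := by rw [real_inner_self_eq_norm_sq, hx]; norm_num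
  have hxe : ∀ q, inner ℝ x (e q) = c q := fun q ↦ real_inner_comm _ _
  -- The test vector flips the components of `x` below `p`, deletes the `p`-th and keeps the rest.
  -- Each remaining component then contributes `(l - lam q) c q ^ 2` with the sign that makes it
  -- positive, so the residual against `v` is at least `g ‖v‖²`.
  set v : H := x - c p • e p - (2 : ℝ) • w with hv
  have hev : ∀ r, inner ℝ (e r) v = if r < p then -c r else if r = p then 0 else c r := fun r ↦ by
    rw [hv, inner_sub_right, inner_sub_right, real_inner_smul_right, real_inner_smul_right, hew,
      horth]
    change c r - _ - _ = _
    rcases lt_trichotomy r p with hr | hr | hr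
    · simp [hr, hr.ne]; ring
    · simp [hr]
    · simp [hr.not_gt, hr.ne']
  have hxv : inner ℝ x v = 1 - c p ^ 2 - 2 * A := by
    rw [hv, inner_sub_right, inner_sub_right, real_inner_smul_right, real_inner_smul_right, hxw,
      hxx, hxe]
    ring
  have hvv : ‖v‖ ^ 2 = 1 - c p ^ 2 := by
    have hwx : inner ℝ w v = -A := by
      rw [hw, sum_inner, hA, ← Finset.sum_neg_distrib]
      refine Finset.sum_congr rfl fun q hq ↦ ?_
      rw [real_inner_smul_left, hev, if_pos (Finset.mem_range.1 hq)]
      ring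
    rw [← real_inner_self_eq_norm_sq]
    nth_rewrite 1 [hv]
    rw [inner_sub_left, inner_sub_left, real_inner_smul_left, real_inner_smul_left, hxv, hwx, hev]
    simp only [lt_irrefl, if_false, if_true]
    ring
  -- `B` is all the mass of `x` outside the span of `e 0, …, e p`, including any part orthogonal to
  -- every `e q`, on which `T` vanishes.
  set B : ℝ := 1 - c p ^ 2 - A with hB
  have hbess : ∀ s : Finset ℕ, ∑ q ∈ s, c q ^ 2 ≤ 1 := fun s ↦ by
    simpa [hx] using h.sum_sq_le s x
  have hA0 : 0 ≤ A := Finset.sum_nonneg fun _ _ ↦ sq_nonneg _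
  have hB0 : 0 ≤ B := by
    have := hbess (Finset.range (p + 1))
    rw [Finset.sum_range_succ] at this
    rw [hB]; linarith
  have hT : T x v ≤ lam (p + 1) * B - ∑ q ∈ Finset.range p, lam q * c q ^ 2 := by
    refine le_of_tendsto' ((h.hasSum x v).tendsto_sum_nat.comp
      (tendsto_add_atTop_nat (p + 1))) fun N ↦ ?_
    simp only [Function.comp_apply, hev]
    rw [add_comm N, Finset.sum_range_add, Finset.sum_range_succ]
    have e1 : ∑ q ∈ Finset.range p, lam q * (inner ℝ (e q) x *
        if q < p then -c q else if q = p then 0 else c q) =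
        -∑ q ∈ Finset.range p, lam q * c q ^ 2 := by
      rw [← Finset.sum_neg_distrib]
      refine Finset.sum_congr rfl fun q hq ↦ ?_
      rw [if_pos (Finset.mem_range.1 hq)]
      change lam q * (c q * _) = _
      ring
    have e2 : ∑ q ∈ Finset.range N, lam (p + 1 + q) * (inner ℝ (e (p + 1 + q)) x *
        if p + 1 + q < p then -c (p + 1 + q) else if p + 1 + q = p then 0 else c (p + 1 + q)) ≤
        lam (p + 1) * B := by
      calc _ ≤ ∑ q ∈ Finset.range N, lam (p + 1) * c (p + 1 + q) ^ 2 := by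
            refine Finset.sum_le_sum fun q _ ↦ ?_
            rw [if_neg (by omega), if_neg (by omega)]
            change lam _ * (c _ * _) ≤ _
            rw [← sq]
            exact mul_le_mul_of_nonneg_right (h.antitone (by omega)) (sq_nonneg _)
        _ ≤ lam (p + 1) * B := by
            rw [← Finset.mul_sum]
            refine mul_le_mul_of_nonneg_left ?_ (h.nonneg _)
            have := hbess (Finset.range (p + 1 + N))
            rw [Finset.sum_range_add, Finset.sum_range_succ] at this
            rw [hB]; linarith
    rw [e1]
    simp only [lt_irrefl, if_false, if_true]
    linarith
  have hkey : g * (A + B) ≤ l * inner ℝ x v - T x v := by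
    have hs : (g + l) * A ≤ ∑ q ∈ Finset.range p, lam q * c q ^ 2 := by
      rw [hA, Finset.mul_sum]
      refine Finset.sum_le_sum fun q hq ↦ mul_le_mul_of_nonneg_right ?_ (sq_nonneg _)
      linarith [hup q (Finset.mem_range.1 hq)]
    have hb : g * B ≤ (l - lam (p + 1)) * B := mul_le_mul_of_nonneg_right hlow hB0
    rw [hxv]
    have : 1 - c p ^ 2 - 2 * A = B - A := by rw [hB]; ring
    rw [this]
    nlinarith
  have hAB : A + B = ‖v‖ ^ 2 := by rw [hvv, hB]; ring
  have hgv : g * ‖v‖ ≤ D := by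
    by_contra! hcon
    have h1 := hkey.trans (hD v)
    rw [hAB] at h1
    rcases (norm_nonneg v).eq_or_lt with h0 | h0
    -- If `v = 0` the inequality to prove is `0 ≤ D`, which follows by testing the residual bound on
    -- `±e (p + 1)`.
    · have hD0 : 0 ≤ D := by
        by_contra! hDn
        have h2 := hD (e (p + 1))
        have h3 := hD (-e (p + 1))
        have hTn : T x (-e (p + 1)) = -T x (e (p + 1)) := by
          refine (h.hasSum x (-e (p + 1))).unique ?_
          simpa using (h.hasSum x (e (p + 1))).neg
        rw [hTn, inner_neg_right, norm_neg, h.orthonormal.1] at h3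
        rw [h.orthonormal.1] at h2
        linarith
      rw [← h0] at hcon
      linarith
    · nlinarith
  have hcp : c p ^ 2 ≤ 1 := by
    have := hbess {p}
    simpa using this
  have hdiv : 1 - c p ^ 2 ≤ (D / g) ^ 2 := by
    rw [← hvv]
    gcongr
    rw [le_div_iff₀ hg]
    linarith
  -- With `s` the sign of `c p`, the squared distance is `2 - 2|c p|`, at most `2 (1 - c p ^ 2)`
  -- because `|c p| ≤ 1`.
  refine ⟨if 0 ≤ c p then 1 else -1, by split_ifs <;> norm_num, ?_⟩
  rw [norm_sub_sq_real, hx, norm_smul, h.orthonormal.1, real_inner_smul_right, hxe]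
  have habs : |c p| ≤ 1 := by
    rw [← abs_one]; exact sq_le_sq.1 (by simpa using hcp)
  split_ifs with h0
  · rw [abs_of_nonneg h0] at habs
    norm_num
    nlinarith
  · push Not at h0
    rw [abs_of_neg h0] at habs
    norm_num
    nlinarith

end SpectralForm

end Hilbert

/-! ### Stability of the normalised squared coefficients. -/

lemma sq_le_of_sign {x y s q E : ℝ} (hq : 0 < q) (hs : s ^ 2 = 1)
    (h : (x - s * y) ^ 2 ≤ q ^ 2 * E) : x ^ 2 ≤ (1 + q) * y ^ 2 + (q ^ 2 + q) * E := by
  -- Young's inequality with weight `q`, written as an identity: the factor `1 + 1/q` on the squared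
  -- error `q ^ 2 * E` becomes `q ^ 2 + q`.
  have hmul : q * ((1 + q) * y ^ 2 + (q ^ 2 + q) * E - x ^ 2) =
      (q * (s * y) - (x - s * y)) ^ 2 + (1 + q) * (q ^ 2 * E - (x - s * y) ^ 2)
        + (q + q ^ 2) * (1 - s ^ 2) * y ^ 2 := by ring
  have h0 : 0 ≤ q * ((1 + q) * y ^ 2 + (q ^ 2 + q) * E - x ^ 2) := by
    rw [hmul, hs]
    have := sub_nonneg.2 h
    positivity
  linarith [nonneg_of_mul_nonneg_right h0 hq]

lemma quotient_bounds {x y s l m η G : ℝ} (hη : 0 < η) (hη1 : η ≤ 1) (hl : 0 < l)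
    (hm : |m - l| ≤ η / 4 * l) (hs : s ^ 2 = 1) (hG : 0 ≤ G)
    (h : (x - s * y) ^ 2 ≤ η ^ 2 / 16 * l * G) :
    x ^ 2 / m ≤ (1 + η) * (y ^ 2 / l) + η * G ∧ (1 - η) * (y ^ 2 / l) - η * G ≤ x ^ 2 / m := by
  -- A quarter of `η` leaves room for the compounded errors of numerator and denominator, for
  -- instance `(1 + q) / (1 - q) ≤ 1 + 4 q`.
  obtain ⟨q, rfl⟩ : ∃ q, η = 4 * q := ⟨η / 4, by ring⟩
  have hq : 0 < q := by linarith
  have hq1 : q ≤ 1 / 4 := by linarith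
  rw [show 4 * q / 4 = q by ring, abs_le] at hm
  have h1 : (x - s * y) ^ 2 ≤ q ^ 2 * (l * G) := h.trans_eq (by ring)
  have h2 : (y - s * x) ^ 2 ≤ q ^ 2 * (l * G) := by
    have : (y - s * x) ^ 2 = (x - s * y) ^ 2 := by
      linear_combination (x ^ 2 - y ^ 2) * hs
    rwa [this]
  have hx := sq_le_of_sign hq hs h1
  have hy := sq_le_of_sign hq hs h2
  have hml : (1 - q) * l ≤ m := by linarith
  have hmu : m ≤ (1 + q) * l := by linarith
  have hm0 : 0 < m := lt_of_lt_of_le (mul_pos (by linarith) hl) hml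
  constructor
  · rw [div_le_iff₀ hm0]
    calc x ^ 2 ≤ (1 + q) * y ^ 2 + (q ^ 2 + q) * (l * G) := hx
      _ ≤ ((1 + 4 * q) * (1 - q)) * y ^ 2 + (4 * q * (1 - q)) * (l * G) := by
          gcongr ?_ * _ + ?_ * _ <;> nlinarith
      _ = ((1 + 4 * q) * (y ^ 2 / l) + 4 * q * G) * ((1 - q) * l) := by
          field_simp
      _ ≤ _ := by gcongr
  · have h3 : x ^ 2 / ((1 + q) * l) ≤ x ^ 2 / m := by gcongr
    refine le_trans ?_ h3
    rw [le_div_iff₀ (by positivity)]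
    have h4 : ((1 - 4 * q) * (y ^ 2 / l) - 4 * q * G) * ((1 + q) * l) =
        (1 - 4 * q) * (1 + q) * y ^ 2 - 4 * q * (1 + q) * (l * G) := by
      field_simp
    rw [h4]
    have h5 : (1 + q) * ((1 - 4 * q) * (1 + q)) ≤ 1 := by nlinarith [pow_pos hq 3]
    have h6 : 0 ≤ l * G := by positivity
    have h7 : (1 + q) * ((1 - 4 * q) * (1 + q) * y ^ 2 - 4 * q * (1 + q) * (l * G)) ≤
        (1 + q) * x ^ 2 := by
      have h8 : (1 + q) * ((1 - 4 * q) * (1 + q)) * y ^ 2 ≤ 1 * y ^ 2 := by gcongr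
      have h9 : (q ^ 2 + q) * (l * G) ≤ (1 + q) * (4 * q * (1 + q)) * (l * G) := by
        gcongr
        nlinarith [pow_pos hq 3]
      linarith
    exact le_of_mul_le_mul_left h7 (by linarith)

variable {H : Type*} [NormedAddCommGroup H] [InnerProductSpace ℝ H]

namespace SpectralForm

/-- Weyl's inequality in both directions. The index types differ, one form having only `n` listed
eigenvalues, and only the ranks of the indices have to match. -/
lemma abs_eigenvalue_sub_le {lam : ℕ → ℝ} {e : ℕ → H} {T : H → H → ℝ} {n : ℕ} {mu : Fin n → ℝ}
    {d : Fin n → H} {S : H → H → ℝ} (h : SpectralForm lam e T) (h' : SpectralForm mu d S) {D : ℝ}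
    (hD : ∀ u v, |S u v - T u v| ≤ D * (‖u‖ * ‖v‖)) (p : Fin n) : |mu p - lam p| ≤ D := by
  have h1 : lam p ≤ mu p + D := h.eigenvalue_le_add h' (fun u ↦ by
    have := (abs_le.1 (hD u u)).1
    rw [sq]; linarith) (by simp)
  have h2 : mu p ≤ lam p + D := h'.eigenvalue_le_add h (fun u ↦ by
    have := (abs_le.1 (hD u u)).2
    rw [sq]; linarith) (by simp)
  rw [abs_le]
  constructor <;> linarith

/-- If `D (p + 1) ^ ((3 β + 2) / 2)` is small, then the `p`-th eigenpair of a form at distance `D`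
yields nearly the same normalised squared coefficients. -/
theorem exists_tolerance {lam : ℕ → ℝ} {e : ℕ → H} {T : H → H → ℝ} (h : SpectralForm lam e T)
    {β : ℝ} (h_decay : EigenvalueDecay lam β) {η : ℝ} (hη : 0 < η) (hη1 : η ≤ 1) :
    ∃ θ : ℝ, 0 < θ ∧ ∀ {n : ℕ} {mu : Fin n → ℝ} {d : Fin n → H} {S : H → H → ℝ} {D : ℝ}, 0 ≤ D →
      SpectralForm mu d S → (∀ u v, |S u v - T u v| ≤ D * (‖u‖ * ‖v‖)) →
      ∀ p : Fin n, D * ((p : ℝ) + 1) ^ ((3 * β + 2) / 2) ≤ θ → ∀ g : H,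
        inner ℝ (d p) g ^ 2 / mu p ≤
          (1 + η) * (inner ℝ (e p) g ^ 2 / lam p) + η * ‖g‖ ^ 2 ∧
        (1 - η) * (inner ℝ (e p) g ^ 2 / lam p) - η * ‖g‖ ^ 2 ≤ inner ℝ (d p) g ^ 2 / mu p := by
  obtain ⟨hβ, C, C₁, C₂, hC, -, hC₂, hdec⟩ := h_decay
  -- The three bounds serve the relative error of the eigenvalue, the survival of half the spectral
  -- gap, and the eigenvector error measured against `√(lam p)`.
  refine ⟨min (η / 4 * C₂) (min (C / 2) (η / 16 * C * √C₂)), by positivity, ?_⟩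
  intro n mu d S D hD0 h' hD p hp g
  set θ := min (η / 4 * C₂) (min (C / 2) (η / 16 * C * √C₂)) with hθ
  have hθ1 : θ ≤ η / 4 * C₂ := min_le_left _ _
  have hθ2 : θ ≤ C / 2 := (min_le_right _ _).trans (min_le_left _ _)
  have hθ3 : θ ≤ η / 16 * C * √C₂ := (min_le_right _ _).trans (min_le_right _ _)
  have hθ0 : 0 < θ := by positivity
  set P : ℝ := (p : ℝ) + 1 with hP
  have hP1 : 1 ≤ P := by simp [hP]
  have hP0 : 0 < P := by linarith
  have hDpow : ∀ r ≤ (3 * β + 2) / 2, D ≤ θ * P ^ (-r) := fun r hr ↦ by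
    rw [Real.rpow_neg hP0.le, ← div_eq_mul_inv, le_div_iff₀ (by positivity)]
    refine le_trans ?_ hp
    gcongr
  have hlam : C₂ * P ^ (-β) ≤ lam p := (hdec p).2.1
  have hlam0 : 0 < lam p := lt_of_lt_of_le (by positivity) hlam
  have hW := h.abs_eigenvalue_sub_le h' hD p
  have hWeyl : |mu p - lam p| ≤ η / 4 * lam p := by
    calc _ ≤ D := hW
      _ ≤ θ * P ^ (-β) := hDpow β (by linarith)
      _ ≤ η / 4 * C₂ * P ^ (-β) := by gcongr
      _ = η / 4 * (C₂ * P ^ (-β)) := by ring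
      _ ≤ _ := by gcongr
  set γ := C * P ^ (-(β + 1)) with hγ
  have hγ0 : 0 < γ := by positivity
  have hDγ : D ≤ γ / 2 := by
    calc D ≤ θ * P ^ (-(β + 1)) := hDpow _ (by linarith)
      _ ≤ C / 2 * P ^ (-(β + 1)) := by gcongr
      _ = γ / 2 := by rw [hγ]; ring
  rw [abs_le] at hW
  -- Since `d p` is an exact eigenvector of `S`, its residual for `T` is `(S - T) (d p) v`. Passing
  -- from `lam p` to `mu p` costs at most `D ≤ γ / 2` of the gap on either side.
  obtain ⟨s, hs, hse⟩ := h.exists_sign_norm_sub_sq_le (x := d p) (l := mu p) (D := D) (g := γ / 2)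
    (p := p) (h'.orthonormal.1 p) (fun v ↦ by
      have := (abs_le.1 (hD (d p) v)).2
      rw [h'.apply_eigenvector, h'.orthonormal.1, one_mul] at this
      exact this) (by positivity) (by
      have : γ ≤ lam p - lam (p + 1) := (hdec p).2.2
      linarith) (fun q hq ↦ by
      have h1 : C * ((q : ℝ) + 1) ^ (-(β + 1)) ≤ lam q - lam (q + 1) := (hdec q).2.2
      have h2 : γ ≤ C * ((q : ℝ) + 1) ^ (-(β + 1)) := by
        rw [hγ]
        refine mul_le_mul_of_nonneg_left
          (Real.rpow_le_rpow_of_nonpos (by positivity) ?_ (by linarith)) hC.le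
        rw [hP]
        have : (q : ℝ) ≤ (p : ℕ) := by exact_mod_cast hq.le
        linarith
      have h3 : lam p ≤ lam (q + 1) := h.antitone hq
      linarith)
  have hclose : ‖d p - s • e p‖ ^ 2 ≤ η ^ 2 / 16 * lam p := by
    refine hse.trans ?_
    have h1 : D / (γ / 2) ≤ 2 * (η / 16 * √C₂) * P ^ (-(β / 2)) := by
      rw [div_le_iff₀ (by positivity)]
      calc D ≤ θ * P ^ (-((3 * β + 2) / 2)) := hDpow _ le_rfl
        _ ≤ η / 16 * C * √C₂ * P ^ (-((3 * β + 2) / 2)) := by gcongr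
        _ = η / 16 * C * √C₂ * (P ^ (-(β / 2)) * P ^ (-(β + 1))) := by
            rw [← Real.rpow_add hP0]; congr 2; ring
        _ = _ := by rw [hγ]; ring
    calc 2 * (D / (γ / 2)) ^ 2 ≤ 2 * (2 * (η / 16 * √C₂) * P ^ (-(β / 2))) ^ 2 := by gcongr
      _ = η ^ 2 / 32 * ((√C₂) ^ 2 * (P ^ (-(β / 2)) * P ^ (-(β / 2)))) := by ring
      _ = η ^ 2 / 32 * (C₂ * P ^ (-β)) := by
          rw [Real.sq_sqrt hC₂.le, ← Real.rpow_add hP0]; congr 3; ring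
      _ ≤ η ^ 2 / 16 * lam p := by gcongr; norm_num
  refine quotient_bounds hη hη1 hlam0 hWeyl hs (sq_nonneg _) ?_
  have : inner ℝ (d p) g - s * inner ℝ (e p) g = inner ℝ (d p - s • e p) g := by
    rw [inner_sub_left, real_inner_smul_left]
  rw [this]
  calc inner ℝ (d p - s • e p) g ^ 2 ≤ (‖d p - s • e p‖ * ‖g‖) ^ 2 := by
        rw [← sq_abs]
        gcongr
        exact abs_real_inner_le_norm _ _
    _ ≤ _ := by rw [mul_pow]; gcongr

end SpectralForm

/-! ### Rates and the truncation level. -/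

lemma tendsto_sqrt_div_log : Tendsto (fun n : ℕ ↦ √n / Real.log n) atTop atTop := by
  have h := (isLittleO_log_rpow_atTop (r := 1 / 2) (by norm_num)).tendsto_div_nhds_zero
  have h2 : Tendsto (fun x : ℝ ↦ Real.log x / x ^ (1 / 2 : ℝ)) atTop (𝓝[>] 0) := by
    refine tendsto_nhdsWithin_iff.2 ⟨h, ?_⟩
    filter_upwards [eventually_gt_atTop 1] with x hx
    exact div_pos (Real.log_pos hx) (Real.rpow_pos_of_pos (by linarith) _)
  refine (h2.inv_tendsto_nhdsGT_zero.comp tendsto_natCast_atTop_atTop).congr fun n ↦ ?_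
  simp [Real.sqrt_eq_rpow]

/-- The indices selected by the threshold are those for which the eigenvalue problem is well
conditioned, and they exhaust `ℕ`. -/
theorem eventually_selection {lam : ℕ → ℝ} {β : ℝ} (h_anti : Antitone lam)
    (h_decay : EigenvalueDecay lam β) {δ : ℕ → ℝ} (hδ_lim : Tendsto δ atTop (𝓝 0))
    (hδ_rate : ∃ C : ℝ, 0 < C ∧ ∀ᶠ n : ℕ in atTop,
      C * (√n / Real.log n) ^ (-(β / (2 * β + 1))) ≤ δ n) {θ : ℝ} (hθ : 0 < θ) (M : ℕ) :
    ∀ᶠ n : ℕ in atTop, ∀ c : ℝ, ∀ p : ℕ, |c - lam p| ≤ (√n / Real.log n)⁻¹ →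
      (δ n ≤ c → (√n / Real.log n)⁻¹ * ((p : ℝ) + 1) ^ ((3 * β + 2) / 2) ≤ θ) ∧
      (p < M → δ n ≤ c) := by
  obtain ⟨hβ, _, C₁, C₂, _, hC₁, hC₂, hdec⟩ := h_decay
  obtain ⟨C, hC, hrate⟩ := hδ_rate
  have hR := tendsto_sqrt_div_log
  set R : ℕ → ℝ := fun n ↦ √n / Real.log n with hRdef
  have hRinv : Tendsto (fun n ↦ (R n)⁻¹) atTop (𝓝 0) := tendsto_inv_atTop_zero.comp hR
  have hβ' : 0 < 2 * β + 1 := by linarith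
  have hlamM : 0 < lam M := lt_of_lt_of_le (by positivity) (hdec M).2.1
  have e1 : ∀ᶠ n in atTop, R n ^ (-((β + 1) / (2 * β + 1))) < C / 2 :=
    ((tendsto_rpow_neg_atTop (by positivity)).comp hR).eventually_lt_const (by positivity)
  set κ := (2 * C₁ / C) ^ ((3 * β + 2) / (2 * β)) with hκ
  have e2 : ∀ᶠ n in atTop, R n ^ (-(β / (4 * β + 2))) < θ / κ :=
    ((tendsto_rpow_neg_atTop (by positivity)).comp hR).eventually_lt_const (by positivity)
  have e3 : ∀ᶠ n in atTop, (R n)⁻¹ < lam M / 2 := hRinv.eventually_lt_const (by positivity)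
  have e4 : ∀ᶠ n in atTop, δ n < lam M / 2 := hδ_lim.eventually_lt_const (by positivity)
  filter_upwards [e1, e2, e3, e4, hrate, hR.eventually_gt_atTop 0] with n h1 h2 h3 h4 h5 hR0
  intro c p hc
  change |c - lam p| ≤ (R n)⁻¹ at hc
  change C * R n ^ (-(β / (2 * β + 1))) ≤ δ n at h5
  rw [abs_le] at hc
  constructor
  · intro hsel
    set P : ℝ := (p : ℝ) + 1 with hP
    have hP0 : 0 < P := by positivity
    -- The perturbation `1 / R n` is of smaller order than the threshold, so a selected index has a
    -- true eigenvalue of at least half the threshold's lower bound.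
    have h6 : (R n)⁻¹ ≤ C / 2 * R n ^ (-(β / (2 * β + 1))) := by
      calc (R n)⁻¹ = R n ^ (-((β + 1) / (2 * β + 1))) * R n ^ (-(β / (2 * β + 1))) := by
            rw [← Real.rpow_add hR0, ← Real.rpow_neg_one]
            congr 1
            field_simp
            ring
        _ ≤ _ := by gcongr
    have h7 : C / 2 * R n ^ (-(β / (2 * β + 1))) ≤ C₁ * P ^ (-β) := by
      have := (hdec p).1
      linarith
    have h8 : P ^ β ≤ 2 * C₁ / C * R n ^ (β / (2 * β + 1)) := by
      rw [Real.rpow_neg hR0.le, Real.rpow_neg hP0.le] at h7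
      have hx : 0 < R n ^ (β / (2 * β + 1)) := by positivity
      have hy : 0 < P ^ β := by positivity
      rw [← div_eq_mul_inv, ← div_eq_mul_inv, div_le_div_iff₀ hx hy] at h7
      rw [div_mul_eq_mul_div, le_div_iff₀ hC]
      linarith
    -- Here `P` is at most of order `R ^ (1 / (2 β + 1))`, and `-1 + (3 β + 2) / (4 β + 2) = -β / (4
    -- β + 2)`.
    calc (R n)⁻¹ * P ^ ((3 * β + 2) / 2)
        = (R n)⁻¹ * (P ^ β) ^ ((3 * β + 2) / (2 * β)) := by
          rw [← Real.rpow_mul hP0.le]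
          congr 2
          field_simp
      _ ≤ (R n)⁻¹ * (2 * C₁ / C * R n ^ (β / (2 * β + 1))) ^ ((3 * β + 2) / (2 * β)) := by
          gcongr
      _ = κ * (R n ^ (-1 : ℝ) * R n ^ (β / (2 * β + 1) * ((3 * β + 2) / (2 * β)))) := by
          rw [Real.mul_rpow (by positivity) (by positivity), ← Real.rpow_mul hR0.le,
            Real.rpow_neg_one, hκ]
          ring
      _ = κ * R n ^ (-(β / (4 * β + 2))) := by
          rw [← Real.rpow_add hR0]
          congr 2
          have : 4 * β + 2 ≠ 0 := by positivity
          field_simp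
          ring
      _ ≤ κ * (θ / κ) := by gcongr
      _ = θ := mul_div_cancel₀ _ (by positivity)
  · intro hpM
    have := h_anti hpM.le
    linarith [show (R n)⁻¹ < lam M / 2 from h3]

/-! ### Kernels as bilinear forms on `L²([0,1])`. -/

lemma integrable_and_hasSum_integral {α ι : Type*} [MeasurableSpace α] {ν : Measure α} [Countable ι]
    {F : ι → α → ℝ} {f : α → ℝ} (hF : ∀ i, Integrable (F i) ν)
    (hs : Summable fun i ↦ ∫ x, ‖F i x‖ ∂ν) (hf : ∀ᵐ x ∂ν, HasSum (fun i ↦ F i x) (f x)) :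
    Integrable f ν ∧ HasSum (fun i ↦ ∫ x, F i x ∂ν) (∫ x, f x ∂ν) := by
  have hmeas : AEStronglyMeasurable f ν :=
    aestronglyMeasurable_of_tendsto_ae atTop
      (f := fun (s : Finset ι) x ↦ ∑ i ∈ s, F i x)
      (fun s ↦ (integrable_finsetSum s fun i _ ↦ hF i).aestronglyMeasurable) hf
  refine ⟨⟨hmeas, ?_⟩, ?_⟩
  · have hle : ∀ᵐ x ∂ν, ‖f x‖ₑ ≤ ∑' i, ‖F i x‖ₑ := by
      filter_upwards [hf] with x hx
      refine le_of_tendsto (hx.enorm) (Eventually.of_forall fun s ↦ ?_)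
      exact (enorm_sum_le s _).trans (ENNReal.sum_le_tsum s)
    refine (lintegral_mono_ae hle).trans_lt ?_
    rw [lintegral_tsum fun i ↦ (hF i).aestronglyMeasurable.enorm]
    have : ∀ i, ∫⁻ x, ‖F i x‖ₑ ∂ν = ENNReal.ofReal (∫ x, ‖F i x‖ ∂ν) := fun i ↦
      (ofReal_integral_norm_eq_lintegral_enorm (hF i)).symm
    simp_rw [this]
    rw [← ENNReal.ofReal_tsum_of_nonneg (fun i ↦ by positivity) hs]
    exact ENNReal.ofReal_lt_top
  · have h := hasSum_integral_of_summable_integral_norm hF hs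
    rwa [integral_congr_ae (g := f) (hf.mono fun x hx ↦ hx.tsum_eq)] at h

lemma coeff_eq_inner {g φ : I → ℝ} (hg : MemLp g 2) (hφ : MemLp φ 2) :
    coeff g φ = inner ℝ (hφ.toLp φ) (hg.toLp g) := by
  rw [L2.inner_def, coeff]
  refine integral_congr_ae ?_
  filter_upwards [hg.coeFn_toLp, hφ.coeFn_toLp] with t h1 h2
  simp [h1, h2]

lemma norm_toLp_sq {α : Type*} [MeasurableSpace α] {ν : Measure α} {g : α → ℝ} (hg : MemLp g 2 ν) :
    ENNReal.ofReal (‖hg.toLp g‖ ^ 2) = ∫⁻ t, ENNReal.ofReal (g t ^ 2) ∂ν := by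
  have h1 : ‖hg.toLp g‖ ^ 2 = ∫ t, g t ^ 2 ∂ν := by
    rw [← real_inner_self_eq_norm_sq, L2.inner_def]
    refine integral_congr_ae ?_
    filter_upwards [hg.coeFn_toLp] with t h
    simp [h, sq]
  rw [h1, ofReal_integral_eq_lintegral_ofReal
    ((memLp_two_iff_integrable_sq hg.1).1 hg) (Eventually.of_forall fun t ↦ sq_nonneg _)]

lemma abs_integral_mul_le {α : Type*} [MeasurableSpace α] {ν : Measure α} {f g : α → ℝ}
    (hf : MemLp f 2 ν) (hg : MemLp g 2 ν) {A B : ℝ} (hA : 0 ≤ A) (hB : 0 ≤ B)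
    (hfA : ∫⁻ t, ENNReal.ofReal (f t ^ 2) ∂ν ≤ ENNReal.ofReal (A ^ 2))
    (hgB : ∫⁻ t, ENNReal.ofReal (g t ^ 2) ∂ν ≤ ENNReal.ofReal (B ^ 2)) :
    |∫ t, f t * g t ∂ν| ≤ A * B := by
  have h1 : ∫ t, f t * g t ∂ν = inner ℝ (hg.toLp g) (hf.toLp f) := by
    rw [L2.inner_def]
    refine integral_congr_ae ?_
    filter_upwards [hf.coeFn_toLp, hg.coeFn_toLp] with t h1 h2
    simp [h1, h2]
  rw [← norm_toLp_sq hf, ENNReal.ofReal_le_ofReal_iff (by positivity)] at hfA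
  rw [← norm_toLp_sq hg, ENNReal.ofReal_le_ofReal_iff (by positivity)] at hgB
  have h2 := abs_le_of_sq_le_sq' hfA hA
  have h3 := abs_le_of_sq_le_sq' hgB hB
  rw [h1]
  calc _ ≤ ‖hg.toLp g‖ * ‖hf.toLp f‖ := abs_real_inner_le_norm _ _
    _ ≤ B * A := by gcongr <;> tauto
    _ = A * B := mul_comm _ _

/-- The bilinear form `∫∫ K(s,t) u(s) v(t) ds dt` of a kernel. -/
noncomputable def kernelForm (K : I → I → ℝ) (u v : Lp ℝ 2 (volume : Measure I)) : ℝ :=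
  ∫ x : I × I, K x.1 x.2 * (u x.1 * v x.2)

section

variable {ι : Type*} [LinearOrder ι] [Countable ι] {K : I → I → ℝ} {lam : ι → ℝ}
  {phi : ι → I → ℝ}

/-- The almost everywhere expansion of the kernel is integrated term by term. Summability of the
eigenvalues supplies the absolute convergence, as the eigenfunctions have norm one. -/
lemma IsEigenDecomposition.integrable_and_hasSum (h : IsEigenDecomposition K lam phi)
    (hlam : Summable lam) (u v : Lp ℝ 2 (volume : Measure I)) :
    Integrable (fun x : I × I ↦ K x.1 x.2 * (u x.1 * v x.2)) ∧
    HasSum (fun p ↦ lam p * (inner ℝ ((h.memLp p).toLp (phi p)) u *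
      inner ℝ ((h.memLp p).toLp (phi p)) v)) (kernelForm K u v) := by
  have hu := Lp.memLp u
  have hv := Lp.memLp v
  have hint : ∀ (p : ι) (w : Lp ℝ 2 (volume : Measure I)), Integrable fun t ↦ w t * phi p t :=
    fun p w ↦ (Lp.memLp w).integrable_mul (h.memLp p)
  have hco : ∀ (p : ι) (w : Lp ℝ 2 (volume : Measure I)),
      ∫ t, w t * phi p t = inner ℝ ((h.memLp p).toLp (phi p)) w := fun p w ↦ by
    have := coeff_eq_inner (Lp.memLp w) (h.memLp p)
    rwa [Lp.toLp_coeFn] at this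
  have hbd : ∀ (p : ι) (w : Lp ℝ 2 (volume : Measure I)),
      ∫ t, ‖w t * phi p t‖ ≤ (∫ t, w t ^ 2) + 1 := fun p w ↦ by
    have h1 : Integrable fun t ↦ w t ^ 2 :=
      (memLp_two_iff_integrable_sq (Lp.memLp w).1).1 (Lp.memLp w)
    have h2 : Integrable fun t ↦ phi p t ^ 2 :=
      (memLp_two_iff_integrable_sq (h.memLp p).1).1 (h.memLp p)
    have h3 : ∫ t, phi p t ^ 2 = 1 := by
      have := h.orthonormal p p
      simpa [coeff, sq] using this
    rw [← h3, ← integral_add h1 h2]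
    refine integral_mono (hint p w).norm (h1.add h2) fun t ↦ ?_
    simp only [norm_mul, Real.norm_eq_abs]
    nlinarith [sq_abs (w t), sq_abs (phi p t), sq_nonneg (|w t| - |phi p t|), sq_nonneg (w t),
      sq_nonneg (phi p t)]
  set F : ι → I × I → ℝ := fun p x ↦ lam p * ((u x.1 * phi p x.1) * (v x.2 * phi p x.2)) with hF
  have hFint : ∀ p, Integrable (F p) := fun p ↦ ((hint p u).mul_prod (hint p v)).const_mul _
  have hFsum : Summable fun p ↦ ∫ x, ‖F p x‖ := by
    refine Summable.of_nonneg_of_le (fun p ↦ by positivity) (fun p ↦ ?_)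
      (hlam.mul_right (((∫ t, u t ^ 2) + 1) * ((∫ t, v t ^ 2) + 1)))
    have : ∫ x, ‖F p x‖ = lam p * ((∫ t, ‖u t * phi p t‖) * ∫ t, ‖v t * phi p t‖) := by
      simp only [hF, norm_mul (lam p), norm_mul (_ * _) (_ * _), Real.norm_of_nonneg (h.nonneg p)]
      rw [integral_const_mul, Measure.volume_eq_prod,
        integral_prod_mul (fun t ↦ ‖u t * phi p t‖) fun t ↦ ‖v t * phi p t‖]
    rw [this]
    refine mul_le_mul_of_nonneg_left ?_ (h.nonneg p)
    exact mul_le_mul (hbd p u) (hbd p v) (by positivity)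
      (add_nonneg (integral_nonneg fun t ↦ sq_nonneg _) zero_le_one)
  have hlim : ∀ᵐ x : I × I, HasSum (fun p ↦ F p x) (K x.1 x.2 * (u x.1 * v x.2)) := by
    filter_upwards [h.expansion] with x hx
    exact (hx.mul_right (u x.1 * v x.2)).congr_fun fun p ↦ by simp only [hF]; ring
  obtain ⟨h1, h2⟩ := integrable_and_hasSum_integral hFint hFsum hlim
  refine ⟨h1, ?_⟩
  refine h2.congr_fun fun p ↦ ?_
  rw [← hco, ← hco, ← integral_prod_mul, ← integral_const_mul, Measure.volume_eq_prod]

/-- An eigen-decomposition of a kernel is a spectral decomposition of its bilinear form. -/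
lemma IsEigenDecomposition.spectralForm (h : IsEigenDecomposition K lam phi)
    (hlam : Summable lam) :
    SpectralForm lam (fun p ↦ (h.memLp p).toLp (phi p)) (kernelForm K) where
  orthonormal := by
    classical
    rw [orthonormal_iff_ite]
    intro p q
    rw [← coeff_eq_inner, h.orthonormal]
    simp [eq_comm]
  nonneg := h.nonneg
  antitone := h.antitone
  hasSum u v := (h.integrable_and_hasSum hlam u v).2

end

lemma EigenvalueDecay.summable {lam : ℕ → ℝ} {β : ℝ} (h : EigenvalueDecay lam β)
    (h0 : ∀ p, 0 ≤ lam p) : Summable lam := by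
  obtain ⟨hβ, _, C₁, _, -, -, -, hdec⟩ := h
  have h1 : Summable fun p : ℕ ↦ ((p : ℝ) + 1) ^ (-β) := by
    have := (summable_nat_add_iff 1).2 (Real.summable_nat_rpow.2 (by linarith : -β < -1))
    simpa using this
  exact Summable.of_nonneg_of_le h0 (fun p ↦ (hdec p).1) (h1.mul_left C₁)

/-- Cauchy–Schwarz on the square: the Hilbert–Schmidt norm dominates the operator norm. -/
lemma abs_kernelForm_sub_le {K L : I → I → ℝ} {u v : Lp ℝ 2 (volume : Measure I)}
    (hK : Integrable fun x : I × I ↦ K x.1 x.2 * (u x.1 * v x.2))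
    (hL : Integrable fun x : I × I ↦ L x.1 x.2 * (u x.1 * v x.2))
    (hmeas : AEStronglyMeasurable (fun x : I × I ↦ L x.1 x.2 - K x.1 x.2)) {D : ℝ} (hD : 0 ≤ D)
    (hKL : ∫⁻ x : I × I, ENNReal.ofReal ((L x.1 x.2 - K x.1 x.2) ^ 2) ≤ ENNReal.ofReal (D ^ 2)) :
    |kernelForm L u v - kernelForm K u v| ≤ D * (‖u‖ * ‖v‖) := by
  have h1 : kernelForm L u v - kernelForm K u v =
      ∫ x : I × I, (L x.1 x.2 - K x.1 x.2) * (u x.1 * v x.2) := by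
    rw [kernelForm, kernelForm, ← integral_sub hL hK]
    simp_rw [sub_mul]
  have hn : ∀ w : Lp ℝ 2 (volume : Measure I),
      ∫⁻ t, ENNReal.ofReal (w t ^ 2) = ENNReal.ofReal (‖w‖ ^ 2) := fun w ↦ by
    have := norm_toLp_sq (Lp.memLp w)
    rw [← this, Lp.toLp_coeFn]
  have hm : ∀ w : Lp ℝ 2 (volume : Measure I), AEMeasurable fun t ↦ ENNReal.ofReal (w t ^ 2) :=
    fun w ↦ ((Lp.aestronglyMeasurable w).aemeasurable.pow_const 2).ennreal_ofReal
  have hsq : ∀ w : Lp ℝ 2 (volume : Measure I), Integrable fun t ↦ w t ^ 2 := fun w ↦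
    (memLp_two_iff_integrable_sq (Lp.memLp w).1).1 (Lp.memLp w)
  rw [h1]
  refine abs_integral_mul_le ?_ ?_ hD (by positivity) hKL (le_of_eq ?_)
  · rw [memLp_two_iff_integrable_sq hmeas]
    refine ⟨hmeas.pow 2, ?_⟩
    rw [hasFiniteIntegral_iff_ofReal (Eventually.of_forall fun x ↦ sq_nonneg _)]
    exact hKL.trans_lt ENNReal.ofReal_lt_top
  · have hms : AEStronglyMeasurable (fun x : I × I ↦ u x.1 * v x.2) :=
      (Lp.aestronglyMeasurable u).comp_fst.mul (Lp.aestronglyMeasurable v).comp_snd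
    rw [memLp_two_iff_integrable_sq hms]
    simp_rw [mul_pow]
    exact (hsq u).mul_prod (hsq v)
  · simp_rw [mul_pow, ENNReal.ofReal_mul (sq_nonneg _)]
    rw [Measure.volume_eq_prod, lintegral_prod_mul (hm u) (hm v), hn, hn]

/-! ### Mean-square accuracy of the empirical covariance kernel. -/

lemma ennreal_add_sq_le (a b : ℝ≥0∞) : (a + b) ^ 2 ≤ 4 * (a ^ 2 + b ^ 2) := by
  rcases le_total a b with h | h
  · calc (a + b) ^ 2 ≤ (b + b) ^ 2 := by gcongr
      _ = 4 * b ^ 2 := by ring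
      _ ≤ 4 * (a ^ 2 + b ^ 2) := by gcongr; exact le_add_self
  · calc (a + b) ^ 2 ≤ (a + a) ^ 2 := by gcongr
      _ = 4 * a ^ 2 := by ring
      _ ≤ 4 * (a ^ 2 + b ^ 2) := by gcongr; exact le_self_add

lemma ofReal_add_sq_le (a b : ℝ) :
    ENNReal.ofReal ((a + b) ^ 2) ≤ 2 * ENNReal.ofReal (a ^ 2) + 2 * ENNReal.ofReal (b ^ 2) := by
  have h : ∀ x : ℝ, 2 * ENNReal.ofReal (x ^ 2) = ENNReal.ofReal (2 * x ^ 2) := fun x ↦ by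
    rw [ENNReal.ofReal_mul (by norm_num)]; simp
  rw [h, h, ← ENNReal.ofReal_add (by positivity) (by positivity)]
  exact ENNReal.ofReal_le_ofReal (by nlinarith [sq_nonneg (a - b)])

lemma eLpNorm_two_sq {α : Type*} [MeasurableSpace α] {ν : Measure α} (g : α → ℝ) :
    eLpNorm g 2 ν ^ 2 = ∫⁻ t, ENNReal.ofReal (g t ^ 2) ∂ν := by
  rw [eLpNorm_eq_lintegral_rpow_enorm_toReal (by norm_num) (by norm_num), ← ENNReal.rpow_natCast,
    ← ENNReal.rpow_mul]
  simp only [ENNReal.toReal_ofNat, Nat.cast_ofNat, ENNReal.rpow_ofNat]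
  rw [show (1 / 2 * 2 : ℝ) = 1 by norm_num, ENNReal.rpow_one]
  refine lintegral_congr fun t ↦ ?_
  rw [← ofReal_norm, ← ENNReal.ofReal_pow (norm_nonneg _), Real.norm_eq_abs, sq_abs]

lemma tendsto_markov {Ω : Type*} [MeasurableSpace Ω] {μ : Measure Ω} {c : ℝ≥0∞} (hc : c ≠ ∞) {W : ℕ → Ω → ℝ≥0∞} (hW : ∀ n, AEMeasurable (W n) μ)
    (hWc : ∀ n, n ≠ 0 → ∫⁻ ω, W n ω ∂μ ≤ (n : ℝ≥0∞)⁻¹ * c) {r : ℕ → ℝ}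
    (hr : ∀ᶠ n in atTop, 0 < r n) (hlim : Tendsto (fun n : ℕ ↦ (n : ℝ)⁻¹ / r n) atTop (𝓝 0)) :
    Tendsto (fun n ↦ μ {ω | ENNReal.ofReal (r n) ≤ W n ω}) atTop (𝓝 0) := by
  have h1 : Tendsto (fun n : ℕ ↦ c * ENNReal.ofReal ((n : ℝ)⁻¹ / r n)) atTop (𝓝 0) := by
    have := ENNReal.Tendsto.const_mul (a := c) (ENNReal.tendsto_ofReal hlim) (Or.inr hc)
    simpa using this
  refine tendsto_of_tendsto_of_tendsto_of_le_of_le' tendsto_const_nhds h1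
    (Eventually.of_forall fun _ ↦ zero_le) ?_
  filter_upwards [hr, eventually_ne_atTop 0] with n hn hn0
  have h2 := meas_ge_le_lintegral_div (hW n) (ε := ENNReal.ofReal (r n)) (by simpa using hn) (by simp)
  refine h2.trans ?_
  have hn' : (0 : ℝ) < n := by positivity
  rw [ENNReal.ofReal_div_of_pos hn, ENNReal.ofReal_inv_of_pos hn', ENNReal.ofReal_natCast,
    ← mul_div_assoc]
  gcongr
  rw [mul_comm]
  exact hWc n hn0

section

variable {Ω : Type*} [MeasurableSpace Ω] {μ : Measure Ω} [IsProbabilityMeasure μ]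

lemma ofReal_integral_sq_le {X : Ω → ℝ} (hX : MemLp X 2 μ) :
    ENNReal.ofReal ((∫ ω, X ω ∂μ) ^ 2) ≤ ∫⁻ ω, ENNReal.ofReal (X ω ^ 2) ∂μ := by
  rw [← ofReal_integral_eq_lintegral_ofReal
    ((memLp_two_iff_integrable_sq hX.1).1 hX) (Eventually.of_forall fun t ↦ sq_nonneg _)]
  refine ENNReal.ofReal_le_ofReal ?_
  have h1 := variance_nonneg X μ
  rw [variance_eq_sub hX] at h1
  have : μ[X ^ 2] = ∫ ω, X ω ^ 2 ∂μ := rfl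
  linarith

/-- The mean square error of a sample mean of `n` i.i.d. random variables. -/
lemma lintegral_mean_sub_sq_le {X : ℕ → Ω → ℝ}
    (h_indep : Pairwise fun i j ↦ IndepFun (X i) (X j) μ)
    (h_ident : ∀ i, IdentDistrib (X i) (X 0) μ μ) {n : ℕ} (hn : n ≠ 0) :
    ∫⁻ ω, ENNReal.ofReal (((1 / (n : ℝ)) * ∑ i : Fin n, X i ω - ∫ ω, X 0 ω ∂μ) ^ 2) ∂μ ≤
      (n : ℝ≥0∞)⁻¹ * ∫⁻ ω, ENNReal.ofReal (X 0 ω ^ 2) ∂μ := by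
  have hm0 := (h_ident 0).aemeasurable_fst
  -- An infinite second moment makes the bound trivial, so the lemma can be applied at every `t` or
  -- `(s, t)` before Tonelli without any integrability check.
  by_cases htop : ∫⁻ ω, ENNReal.ofReal (X 0 ω ^ 2) ∂μ = ∞
  · rw [htop, ENNReal.mul_top (by simp)]
    exact le_top
  have hX0 : MemLp (X 0) 2 μ := by
    rw [memLp_two_iff_integrable_sq hm0.aestronglyMeasurable]
    refine ⟨(hm0.pow_const 2).aestronglyMeasurable, ?_⟩
    rw [hasFiniteIntegral_iff_ofReal (Eventually.of_forall fun x ↦ sq_nonneg _)]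
    exact lt_top_iff_ne_top.2 htop
  have hX : ∀ i, MemLp (X i) 2 μ := fun i ↦ (h_ident i).memLp_iff.2 hX0
  have hn' : (n : ℝ) ≠ 0 := by exact_mod_cast hn
  set Y : Ω → ℝ := fun ω ↦ (1 / (n : ℝ)) * (∑ i ∈ Finset.range n, X i) ω with hY
  have hS : MemLp (∑ i ∈ Finset.range n, X i) 2 μ := memLp_finsetSum' _ fun i _ ↦ hX i
  have hYL : MemLp Y 2 μ := hS.const_mul _
  have hEY : ∫ ω, Y ω ∂μ = ∫ ω, X 0 ω ∂μ := by
    simp only [hY, Finset.sum_apply]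
    rw [integral_const_mul, integral_finsetSum _ fun i _ ↦ (hX i).integrable (by norm_num)]
    simp_rw [fun i ↦ (h_ident i).integral_eq]
    simp only [Finset.sum_const, Finset.card_range, nsmul_eq_mul]
    field_simp
  have hVar : Var[Y; μ] = (n : ℝ)⁻¹ * Var[X 0; μ] := by
    rw [hY, variance_const_mul, IndepFun.variance_sum (fun i _ ↦ hX i)
      (fun i _ j _ hij ↦ h_indep hij)]
    simp_rw [fun i ↦ (h_ident i).variance_eq]
    simp only [Finset.sum_const, Finset.card_range, nsmul_eq_mul]
    field_simp
  have h1 : ∀ ω, (1 / (n : ℝ)) * ∑ i : Fin n, X i ω = Y ω := fun ω ↦ by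
    simp only [hY, Finset.sum_apply, Fin.sum_univ_eq_sum_range (fun i ↦ X i ω)]
  simp_rw [h1, ← hEY]
  have hint : Integrable (fun ω ↦ (Y ω - ∫ ω, Y ω ∂μ) ^ 2) μ :=
    (memLp_two_iff_integrable_sq (hYL.sub (memLp_const _)).1).1 (hYL.sub (memLp_const _))
  rw [← ofReal_integral_eq_lintegral_ofReal hint (Eventually.of_forall fun t ↦ sq_nonneg _),
    ← ofReal_integral_eq_lintegral_ofReal ((memLp_two_iff_integrable_sq hX0.1).1 hX0)
      (Eventually.of_forall fun t ↦ sq_nonneg _), ← variance_eq_integral hYL.1.aemeasurable, hVar,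
    ENNReal.ofReal_mul (by positivity), ENNReal.ofReal_inv_of_pos (by positivity),
    ENNReal.ofReal_natCast]
  gcongr
  exact variance_le_expectation_sq hX0.1

variable {f : ℕ → Ω → I → ℝ}

lemma integral_sampleMean_sub_mean (hf_meas : ∀ i, Measurable (Function.uncurry (f i)))
    (hf_indep : iIndepFun f μ) (hf_ident : ∀ i, IdentDistrib (f i) (f 0) μ μ)
    {n : ℕ} (hn : n ≠ 0) :
    ∫⁻ ω, (∫⁻ t, ENNReal.ofReal
        ((sampleMean (fun i : Fin n ↦ f i ω) t - ∫ ω', f 0 ω' t ∂μ) ^ 2)) ∂μ ≤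
      (n : ℝ≥0∞)⁻¹ * ∫⁻ ω, (∫⁻ t, ENNReal.ofReal (f 0 ω t ^ 2)) ∂μ := by
  have hm : Measurable fun t ↦ ∫ ω, f 0 ω t ∂μ :=
    ((hf_meas 0).stronglyMeasurable.integral_prod_left).measurable
  have hsq : Measurable fun z : Ω × I ↦ ENNReal.ofReal (f 0 z.1 z.2 ^ 2) :=
    ((hf_meas 0).pow_const 2).ennreal_ofReal
  have hs : ∀ i, Measurable fun z : Ω × I ↦ f i z.1 z.2 := hf_meas
  have hswap : ∫⁻ ω, (∫⁻ t, ENNReal.ofReal (f 0 ω t ^ 2)) ∂μ =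
      ∫⁻ t, (∫⁻ ω, ENNReal.ofReal (f 0 ω t ^ 2) ∂μ) := lintegral_lintegral_swap hsq.aemeasurable
  rw [hswap, lintegral_lintegral_swap, ← lintegral_const_mul' _ _ (by simp [hn])]
  · refine lintegral_mono fun t ↦ ?_
    exact lintegral_mean_sub_sq_le (X := fun i ω ↦ f i ω t)
      (fun i j hij ↦ (hf_indep.comp (fun _ x ↦ x t) (fun _ ↦ measurable_pi_apply t)).indepFun hij)
      (fun i ↦ (hf_ident i).comp (measurable_pi_apply t)) hn
  · refine Measurable.aemeasurable ?_
    simp only [Function.uncurry_def, sampleMean]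
    have : Measurable fun z : Ω × I ↦ ∫ ω, f 0 ω z.2 ∂μ := hm.comp measurable_snd
    fun_prop

/-- The empirical covariance kernel centred at the true mean. -/
noncomputable def centredKernel {n : ℕ} (m : I → ℝ) (x : Fin n → I → ℝ) (s t : I) : ℝ :=
  (1 / (n : ℝ)) * ∑ i, (x i s - m s) * (x i t - m t)

/-- Centring at the sample mean instead of the true mean costs a rank-one term, whose squared `L²`
norm is the square of that of the error of the mean. -/
lemma empKernel_eq {n : ℕ} (hn : n ≠ 0) (m : I → ℝ) (x : Fin n → I → ℝ) (s t : I) :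
    empKernel x s t = centredKernel m x s t - (sampleMean x s - m s) * (sampleMean x t - m t) := by
  have hn' : (n : ℝ) ≠ 0 := by exact_mod_cast hn
  have h1 : ∀ t, ∑ i, x i t = n * sampleMean x t := fun t ↦ by
    rw [sampleMean]; field_simp
  have h2 : ∀ a b : I → ℝ, ∑ i, (x i s - a s) * (x i t - b t) =
      ∑ i, x i s * x i t - n * sampleMean x s * b t - a s * (n * sampleMean x t)
        + n * (a s * b t) := fun a b ↦ by
    rw [← h1, ← h1, Finset.sum_mul, Finset.mul_sum, ← Finset.sum_sub_distrib,
      ← Finset.sum_sub_distrib]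
    have : (n : ℝ) * (a s * b t) = ∑ _i : Fin n, a s * b t := by simp
    rw [this, ← Finset.sum_add_distrib]
    exact Finset.sum_congr rfl fun i _ ↦ by ring
  rw [empKernel, centredKernel, h2, h2]
  field_simp
  ring

lemma measurable_covKernel {g : Ω → I → ℝ} (hg : Measurable (Function.uncurry g)) :
    Measurable fun x : I × I ↦ covKernel μ g x.1 x.2 := by
  have hm : Measurable fun t ↦ ∫ ω, g ω t ∂μ :=
    (hg.stronglyMeasurable.integral_prod_left).measurable
  have hg' : Measurable fun z : Ω × I ↦ g z.1 z.2 := hg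
  have : Measurable (Function.uncurry fun (ω : Ω) (x : I × I) ↦
      (g ω x.1 - ∫ ω', g ω' x.1 ∂μ) * (g ω x.2 - ∫ ω', g ω' x.2 ∂μ)) := by
    simp only [Function.uncurry_def]
    have h1 : Measurable fun z : Ω × I × I ↦ g z.1 z.2.1 :=
      hg'.comp (measurable_fst.prodMk (measurable_fst.comp measurable_snd))
    have h2 : Measurable fun z : Ω × I × I ↦ g z.1 z.2.2 :=
      hg'.comp (measurable_fst.prodMk (measurable_snd.comp measurable_snd))
    have h3 : Measurable fun z : Ω × I × I ↦ ∫ ω', g ω' z.2.1 ∂μ :=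
      hm.comp (measurable_fst.comp measurable_snd)
    have h4 : Measurable fun z : Ω × I × I ↦ ∫ ω', g ω' z.2.2 ∂μ :=
      hm.comp (measurable_snd.comp measurable_snd)
    exact (h1.sub h3).mul (h2.sub h4)
  exact (this.stronglyMeasurable.integral_prod_left).measurable

/-- At each `(s, t)` the centred kernel is an average of i.i.d. products with mean `K(s, t)`;
Tonelli then integrates the pointwise variance bound, and the double integral of the squared product
factorises. -/
lemma integral_centredKernel_sub_covKernel (hf_meas : ∀ i, Measurable (Function.uncurry (f i)))
    (hf_indep : iIndepFun f μ) (hf_ident : ∀ i, IdentDistrib (f i) (f 0) μ μ)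
    {n : ℕ} (hn : n ≠ 0) :
    ∫⁻ ω, (∫⁻ x : I × I, ENNReal.ofReal
        ((centredKernel (fun t ↦ ∫ ω', f 0 ω' t ∂μ) (fun i : Fin n ↦ f i ω) x.1 x.2
          - covKernel μ (f 0) x.1 x.2) ^ 2)) ∂μ ≤
      (n : ℝ≥0∞)⁻¹ *
        ∫⁻ ω, (∫⁻ t, ENNReal.ofReal ((f 0 ω t - ∫ ω', f 0 ω' t ∂μ) ^ 2)) ^ 2 ∂μ := by
  set m : I → ℝ := fun t ↦ ∫ ω, f 0 ω t ∂μ with hmdef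
  have hm : Measurable m := ((hf_meas 0).stronglyMeasurable.integral_prod_left).measurable
  have hs : ∀ i, Measurable fun z : Ω × I × I ↦ f i z.1 z.2.1 := fun i ↦
    (hf_meas i).comp (measurable_fst.prodMk (measurable_fst.comp measurable_snd))
  have ht : ∀ i, Measurable fun z : Ω × I × I ↦ f i z.1 z.2.2 := fun i ↦
    (hf_meas i).comp (measurable_fst.prodMk (measurable_snd.comp measurable_snd))
  have hms : Measurable fun z : Ω × I × I ↦ m z.2.1 := by fun_prop
  have hmt : Measurable fun z : Ω × I × I ↦ m z.2.2 := by fun_prop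
  have hprod : ∀ ω, (∫⁻ t, ENNReal.ofReal ((f 0 ω t - m t) ^ 2)) ^ 2 =
      ∫⁻ x : I × I, ENNReal.ofReal (((f 0 ω x.1 - m x.1) * (f 0 ω x.2 - m x.2)) ^ 2) := fun ω ↦ by
    have : Measurable fun t ↦ ENNReal.ofReal ((f 0 ω t - m t) ^ 2) := by
      have : Measurable fun t ↦ f 0 ω t := (hf_meas 0).of_uncurry_left
      fun_prop
    simp_rw [mul_pow, ENNReal.ofReal_mul (sq_nonneg _)]
    rw [Measure.volume_eq_prod, lintegral_prod_mul this.aemeasurable this.aemeasurable, sq]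
  change _ ≤ _ * ∫⁻ ω, (∫⁻ t, ENNReal.ofReal ((f 0 ω t - m t) ^ 2)) ^ 2 ∂μ
  rw [lintegral_congr hprod]
  have hswap : ∫⁻ ω, (∫⁻ x : I × I,
      ENNReal.ofReal (((f 0 ω x.1 - m x.1) * (f 0 ω x.2 - m x.2)) ^ 2)) ∂μ =
      ∫⁻ x : I × I, (∫⁻ ω,
        ENNReal.ofReal (((f 0 ω x.1 - m x.1) * (f 0 ω x.2 - m x.2)) ^ 2) ∂μ) := by
    refine lintegral_lintegral_swap (Measurable.aemeasurable ?_)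
    simp only [Function.uncurry_def]
    fun_prop
  rw [hswap, lintegral_lintegral_swap, ← lintegral_const_mul' _ _ (by simp [hn])]
  · refine lintegral_mono fun x ↦ ?_
    have hmeas : Measurable fun y : I → ℝ ↦ (y x.1 - m x.1) * (y x.2 - m x.2) := by fun_prop
    exact lintegral_mean_sub_sq_le (X := fun i ω ↦ (f i ω x.1 - m x.1) * (f i ω x.2 - m x.2))
      (fun i j hij ↦ (hf_indep.comp (fun _ y ↦ (y x.1 - m x.1) * (y x.2 - m x.2))
        (fun _ ↦ hmeas)).indepFun hij) (fun i ↦ (hf_ident i).comp hmeas) hn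
  · refine Measurable.aemeasurable ?_
    simp only [Function.uncurry_def, centredKernel]
    have : Measurable fun z : Ω × I × I ↦ covKernel μ (f 0) z.2.1 z.2.2 :=
      (measurable_covKernel (hf_meas 0)).comp measurable_snd
    fun_prop

lemma lintegral_empKernel_sub_le {n : ℕ} (hn : n ≠ 0) {m : I → ℝ} (hm : Measurable m)
    {x : Fin n → I → ℝ} (hx : ∀ i, Measurable (x i)) {K : I → I → ℝ}
    (hK : Measurable fun z : I × I ↦ K z.1 z.2) :
    ∫⁻ z : I × I, ENNReal.ofReal ((empKernel x z.1 z.2 - K z.1 z.2) ^ 2) ≤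
      2 * (∫⁻ z : I × I, ENNReal.ofReal ((centredKernel m x z.1 z.2 - K z.1 z.2) ^ 2)) +
      2 * (∫⁻ t, ENNReal.ofReal ((sampleMean x t - m t) ^ 2)) ^ 2 := by
  have hmeas1 : Measurable fun t ↦ ENNReal.ofReal ((sampleMean x t - m t) ^ 2) := by
    simp only [sampleMean]; fun_prop
  have hmeas2 : Measurable fun z : I × I ↦
      ENNReal.ofReal ((centredKernel m x z.1 z.2 - K z.1 z.2) ^ 2) := by
    simp only [centredKernel]; fun_prop
  have hprod : (∫⁻ t, ENNReal.ofReal ((sampleMean x t - m t) ^ 2)) ^ 2 =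
      ∫⁻ z : I × I, ENNReal.ofReal ((-((sampleMean x z.1 - m z.1) *
        (sampleMean x z.2 - m z.2))) ^ 2) := by
    simp_rw [neg_sq, mul_pow, ENNReal.ofReal_mul (sq_nonneg _)]
    rw [Measure.volume_eq_prod, lintegral_prod_mul hmeas1.aemeasurable hmeas1.aemeasurable, sq]
  rw [hprod, ← lintegral_const_mul' _ _ (by simp), ← lintegral_const_mul' _ _ (by simp),
    ← lintegral_add_left (hmeas2.const_mul 2)]
  refine lintegral_mono fun z ↦ ?_
  refine le_trans (le_of_eq ?_) (ofReal_add_sq_le _ _)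
  rw [empKernel_eq hn m]
  ring_nf

lemma second_moment_lt_top {g : Ω → I → ℝ}
    (h4 : ∫⁻ ω, eLpNorm (g ω) 2 volume ^ 4 ∂μ < ∞) :
    ∫⁻ ω, (∫⁻ t, ENNReal.ofReal (g ω t ^ 2)) ∂μ < ∞ := by
  have h : ∀ a : ℝ≥0∞, a ≤ 1 + a ^ 2 := fun a ↦ by
    rcases le_total a 1 with h | h
    · exact h.trans le_self_add
    · exact (le_self_pow₀ h (by norm_num)).trans le_add_self
  calc _ ≤ ∫⁻ ω, (1 + eLpNorm (g ω) 2 volume ^ 4) ∂μ := by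
        refine lintegral_mono fun ω ↦ ?_
        rw [show eLpNorm (g ω) 2 volume ^ 4 = (eLpNorm (g ω) 2 volume ^ 2) ^ 2 by ring,
          eLpNorm_two_sq]
        exact h _
    _ < ∞ := by
        rw [lintegral_add_left measurable_const]
        simpa using h4

lemma centred_fourth_moment_lt_top {g : Ω → I → ℝ} (hg : Measurable (Function.uncurry g))
    (h2 : ∀ t, MemLp (fun ω ↦ g ω t) 2 μ)
    (h4 : ∫⁻ ω, eLpNorm (g ω) 2 volume ^ 4 ∂μ < ∞) :
    ∫⁻ ω, (∫⁻ t, ENNReal.ofReal ((g ω t - ∫ ω', g ω' t ∂μ) ^ 2)) ^ 2 ∂μ < ∞ := by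
  set m : I → ℝ := fun t ↦ ∫ ω, g ω t ∂μ with hmdef
  have hm : Measurable m := (hg.stronglyMeasurable.integral_prod_left).measurable
  have hsq : Measurable fun z : Ω × I ↦ ENNReal.ofReal (g z.1 z.2 ^ 2) :=
    (hg.pow_const 2).ennreal_ofReal
  set c := ∫⁻ t, ENNReal.ofReal (m t ^ 2) with hc
  have hc_top : c < ∞ := by
    refine lt_of_le_of_lt ?_ (second_moment_lt_top h4)
    rw [lintegral_lintegral_swap hsq.aemeasurable]
    exact lintegral_mono fun t ↦ ofReal_integral_sq_le (h2 t)
  have hbd : ∀ ω, (∫⁻ t, ENNReal.ofReal ((g ω t - m t) ^ 2)) ^ 2 ≤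
      16 * eLpNorm (g ω) 2 volume ^ 4 + 16 * c ^ 2 := fun ω ↦ by
    have hgω : Measurable fun t ↦ g ω t := hg.of_uncurry_left
    have h1 : ∫⁻ t, ENNReal.ofReal ((g ω t - m t) ^ 2) ≤
        2 * (∫⁻ t, ENNReal.ofReal (g ω t ^ 2)) + 2 * c := by
      rw [hc, ← lintegral_const_mul' _ _ (by simp), ← lintegral_const_mul' _ _ (by simp),
        ← lintegral_add_left (by fun_prop)]
      refine lintegral_mono fun t ↦ ?_
      simpa [sub_eq_add_neg] using ofReal_add_sq_le (g ω t) (-m t)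
    calc _ ≤ (2 * (∫⁻ t, ENNReal.ofReal (g ω t ^ 2)) + 2 * c) ^ 2 := by gcongr
      _ ≤ 4 * ((2 * (∫⁻ t, ENNReal.ofReal (g ω t ^ 2))) ^ 2 + (2 * c) ^ 2) :=
          ennreal_add_sq_le _ _
      _ = 16 * (∫⁻ t, ENNReal.ofReal (g ω t ^ 2)) ^ 2 + 16 * c ^ 2 := by ring
      _ = _ := by rw [← eLpNorm_two_sq]; ring
  refine (lintegral_mono hbd).trans_lt ?_
  rw [lintegral_add_right _ measurable_const, lintegral_const_mul' _ _ (by simp)]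
  refine ENNReal.add_lt_top.2 ⟨ENNReal.mul_lt_top (by simp) h4, ?_⟩
  simp only [lintegral_const, measure_univ, mul_one]
  exact ENNReal.mul_lt_top (by simp) (ENNReal.pow_lt_top hc_top)

/-- With probability tending to one, the empirical covariance kernel is within `log n / √n` of the
covariance kernel, in `L²([0,1]²)`. -/
theorem tendsto_measure_empKernel_far
    (hf_meas : ∀ i, Measurable (Function.uncurry (f i)))
    (hf_indep : iIndepFun f μ) (hf_ident : ∀ i, IdentDistrib (f i) (f 0) μ μ)
    (hf_second : ∀ t, MemLp (fun ω ↦ f 0 ω t) 2 μ)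
    (hf_fourth : ∫⁻ ω, eLpNorm (f 0 ω) 2 volume ^ 4 ∂μ < ∞) :
    Tendsto (fun n : ℕ ↦ μ {ω | ¬ ∫⁻ x : I × I, ENNReal.ofReal
      ((empKernel (fun i : Fin n ↦ f i ω) x.1 x.2 - covKernel μ (f 0) x.1 x.2) ^ 2) ≤
        ENNReal.ofReal ((√n / Real.log n)⁻¹ ^ 2)}) atTop (𝓝 0) := by
  set m : I → ℝ := fun t ↦ ∫ ω, f 0 ω t ∂μ with hmdef
  have hm : Measurable m := ((hf_meas 0).stronglyMeasurable.integral_prod_left).measurable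
  have hKm := measurable_covKernel (μ := μ) (hf_meas 0)
  set R : ℕ → ℝ := fun n ↦ √n / Real.log n with hR
  have hRlim : Tendsto R atTop atTop := tendsto_sqrt_div_log
  have hlog : Tendsto (fun n : ℕ ↦ Real.log n) atTop atTop :=
    Real.tendsto_log_atTop.comp tendsto_natCast_atTop_atTop
  set W1 : ℕ → Ω → ℝ≥0∞ := fun n ω ↦
    ∫⁻ t, ENNReal.ofReal ((sampleMean (fun i : Fin n ↦ f i ω) t - m t) ^ 2) with hW1
  set W2 : ℕ → Ω → ℝ≥0∞ := fun n ω ↦ ∫⁻ x : I × I, ENNReal.ofReal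
    ((centredKernel m (fun i : Fin n ↦ f i ω) x.1 x.2 - covKernel μ (f 0) x.1 x.2) ^ 2) with hW2
  have hf' : ∀ i, Measurable fun z : Ω × I ↦ f i z.1 z.2 := hf_meas
  have hW1m : ∀ n, Measurable (W1 n) := fun n ↦ by
    refine Measurable.lintegral_prod_right' (f := fun z : Ω × I ↦ ENNReal.ofReal
      ((sampleMean (fun i : Fin n ↦ f i z.1) z.2 - m z.2) ^ 2)) ?_
    simp only [sampleMean]
    fun_prop
  have hW2m : ∀ n, Measurable (W2 n) := fun n ↦ by
    refine Measurable.lintegral_prod_right' (f := fun z : Ω × I × I ↦ ENNReal.ofReal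
      ((centredKernel m (fun i : Fin n ↦ f i z.1) z.2.1 z.2.2 -
        covKernel μ (f 0) z.2.1 z.2.2) ^ 2)) ?_
    have hs : ∀ i, Measurable fun z : Ω × I × I ↦ f i z.1 z.2.1 := fun i ↦
      (hf_meas i).comp (measurable_fst.prodMk (measurable_fst.comp measurable_snd))
    have ht : ∀ i, Measurable fun z : Ω × I × I ↦ f i z.1 z.2.2 := fun i ↦
      (hf_meas i).comp (measurable_fst.prodMk (measurable_snd.comp measurable_snd))
    have : Measurable fun z : Ω × I × I ↦ covKernel μ (f 0) z.2.1 z.2.2 :=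
      hKm.comp measurable_snd
    simp only [centredKernel]
    fun_prop
  have hloginv : Tendsto (fun n : ℕ ↦ (Real.log n)⁻¹) atTop (𝓝 0) :=
    tendsto_inv_atTop_zero.comp hlog
  have hRinv : Tendsto (fun n : ℕ ↦ (R n)⁻¹) atTop (𝓝 0) := tendsto_inv_atTop_zero.comp hRlim
  have hRpos : ∀ᶠ n in atTop, 0 < R n := hRlim.eventually_gt_atTop 0
  have hlogpos : ∀ᶠ n : ℕ in atTop, 0 < Real.log n := hlog.eventually_gt_atTop 0
  have l1 : Tendsto (fun n : ℕ ↦ (n : ℝ)⁻¹ / ((R n)⁻¹ / 2)) atTop (𝓝 0) := by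
    have : Tendsto (fun n : ℕ ↦ 2 * ((R n)⁻¹ * (Real.log n)⁻¹ ^ 2)) atTop (𝓝 0) := by
      simpa using (hRinv.mul (hloginv.pow 2)).const_mul 2
    refine this.congr' ?_
    filter_upwards [hRpos, hlogpos, eventually_gt_atTop 0] with n h1 h2 h3
    have h3' : (0 : ℝ) < n := by exact_mod_cast h3
    have h4 : √(n : ℝ) ^ 2 = n := Real.sq_sqrt h3'.le
    have h5 : 0 < √(n : ℝ) := Real.sqrt_pos.2 h3'
    simp only [hR]
    field_simp
    exact h4.symm
  -- This ratio equals `4 / (log n)²`: the logarithm in the rate is what makes Markov's inequality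
  -- conclusive.
  have l2 : Tendsto (fun n : ℕ ↦ (n : ℝ)⁻¹ / ((R n)⁻¹ ^ 2 / 4)) atTop (𝓝 0) := by
    have : Tendsto (fun n : ℕ ↦ 4 * (Real.log n)⁻¹ ^ 2) atTop (𝓝 0) := by
      simpa using (hloginv.pow 2).const_mul 4
    refine this.congr' ?_
    filter_upwards [hRpos, hlogpos, eventually_gt_atTop 0] with n h1 h2 h3
    have h3' : (0 : ℝ) < n := by exact_mod_cast h3
    simp only [hR, inv_div, div_pow, Real.sq_sqrt h3'.le]
    field_simp
  -- The levels `R⁻¹ / 2` for the mean and `R⁻² / 4` for the centred kernel are chosen so that `2 ·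
  -- R⁻² / 4 + 2 · (R⁻¹ / 2)² = R⁻²`.
  have t1 := tendsto_markov (second_moment_lt_top hf_fourth).ne (fun n ↦ (hW1m n).aemeasurable)
    (fun n hn ↦ integral_sampleMean_sub_mean hf_meas hf_indep hf_ident hn)
    (hRpos.mono fun n h ↦ by positivity) l1
  have t2 := tendsto_markov (centred_fourth_moment_lt_top (hf_meas 0) hf_second hf_fourth).ne
    (fun n ↦ (hW2m n).aemeasurable)
    (fun n hn ↦ integral_centredKernel_sub_covKernel hf_meas hf_indep hf_ident hn)
    (hRpos.mono fun n h ↦ by positivity) l2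
  have t3 := t1.add t2
  rw [add_zero] at t3
  refine tendsto_of_tendsto_of_tendsto_of_le_of_le' tendsto_const_nhds t3
    (Eventually.of_forall fun _ ↦ zero_le) ?_
  filter_upwards [eventually_ne_atTop 0, hRpos] with n hn hRn
  refine (measure_mono fun ω hω ↦ ?_).trans (measure_union_le _ _)
  by_contra hcon
  rw [Set.mem_union, not_or, Set.mem_ofPred_eq, Set.mem_ofPred_eq, not_le, not_le] at hcon
  refine hω ((lintegral_empKernel_sub_le hn hm (fun i ↦ (hf_meas i).of_uncurry_left) hKm).trans ?_)
  calc _ ≤ 2 * ENNReal.ofReal ((R n)⁻¹ ^ 2 / 4) + 2 * ENNReal.ofReal ((R n)⁻¹ / 2) ^ 2 := by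
        gcongr
        · exact hcon.2.le
        · exact hcon.1.le
    _ = ENNReal.ofReal ((R n)⁻¹ ^ 2) := by
        rw [← ENNReal.ofReal_pow (by positivity), show ((R n)⁻¹ / 2) ^ 2 = (R n)⁻¹ ^ 2 / 4 by ring,
          ← two_mul, ← mul_assoc, show (2 * 2 : ℝ≥0∞) = ENNReal.ofReal 4 by norm_num,
          ← ENNReal.ofReal_mul (by norm_num)]
        congr 1
        ring

end

/-! ### Measurable versions of path integrals and the law of large numbers. -/

/-- Monte Carlo integration. -/
lemma ae_tendsto_average_sample {h : I → ℝ} (hm : Measurable h) (hi : Integrable h) :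
    ∀ᵐ u ∂Measure.infinitePi fun _ : ℕ ↦ (volume : Measure I),
      Tendsto (fun N : ℕ ↦ (∑ j ∈ Finset.range N, h (u j)) / N) atTop (𝓝 (∫ t, h t)) := by
  set P := Measure.infinitePi fun _ : ℕ ↦ (volume : Measure I) with hP
  have hmp : ∀ j, MeasurePreserving (Function.eval j) P (volume : Measure I) := fun j ↦
    measurePreserving_eval_infinitePi _ j
  have hid : ∀ j, IdentDistrib (fun u : ℕ → I ↦ h (u j)) (fun u : ℕ → I ↦ h (u 0)) P P := fun j ↦ by
    have : IdentDistrib (Function.eval j : (ℕ → I) → I) (Function.eval 0) P P :=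
      ⟨(hmp j).aemeasurable, (hmp 0).aemeasurable, by rw [(hmp j).map_eq, (hmp 0).map_eq]⟩
    exact this.comp hm
  have hint : Integrable (fun u : ℕ → I ↦ h (u 0)) P := (hmp 0).integrable_comp_of_integrable hi
  have hE : ∫ u, h (u 0) ∂P = ∫ t, h t := by
    rw [← (hmp 0).map_eq, integral_map (hmp 0).aemeasurable hm.aestronglyMeasurable]
  have := strong_law_ae_real (fun j (u : ℕ → I) ↦ h (u j)) hint
    (fun i j hij ↦ (iIndepFun_infinitePi (P := fun _ : ℕ ↦ (volume : Measure I))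
      (X := fun _ ↦ h) (fun _ ↦ hm)).indepFun hij) hid
  rwa [hE] at this

section

variable {Ω : Type*} [MeasurableSpace Ω] {μ : Measure Ω} [IsProbabilityMeasure μ]
  {f : ℕ → Ω → I → ℝ}

/-- There are sampling points at which Monte Carlo integration along the paths of countably many
measurable processes succeeds almost surely. -/
lemma exists_sampling_points (hf_meas : ∀ i, Measurable (Function.uncurry (f i))) {κ : Type*}
    [Countable κ] {ψ : κ → ℝ × I → ℝ} (hψ : ∀ k, Measurable (ψ k))
    (hint : ∀ i k, ∀ᵐ ω ∂μ, Integrable fun t ↦ ψ k (f i ω t, t)) :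
    ∃ u : ℕ → I, ∀ i k, ∀ᵐ ω ∂μ, Tendsto
      (fun N : ℕ ↦ (∑ j ∈ Finset.range N, ψ k (f i ω (u j), u j)) / N) atTop
      (𝓝 (∫ t, ψ k (f i ω t, t))) := by
  set P := Measure.infinitePi fun _ : ℕ ↦ (volume : Measure I) with hP
  suffices h : ∀ i k, ∀ᵐ u ∂P, ∀ᵐ ω ∂μ, Tendsto
      (fun N : ℕ ↦ (∑ j ∈ Finset.range N, ψ k (f i ω (u j), u j)) / N) atTop
      (𝓝 (∫ t, ψ k (f i ω t, t))) from
    (ae_all_iff.2 fun i ↦ ae_all_iff.2 fun k ↦ h i k).exists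
  intro i k
  have hpath : Measurable fun z : Ω × I ↦ ψ k (f i z.1 z.2, z.2) :=
    (hψ k).comp ((hf_meas i).prodMk measurable_snd)
  have hset : MeasurableSet {z : Ω × (ℕ → I) | Tendsto
      (fun N : ℕ ↦ (∑ j ∈ Finset.range N, ψ k (f i z.1 (z.2 j), z.2 j)) / N) atTop
      (𝓝 (∫ t, ψ k (f i z.1 t, t)))} := by
    have hL : Measurable fun ω ↦ ∫ t, ψ k (f i ω t, t) :=
      (hpath.stronglyMeasurable.integral_prod_right).measurable
    have hm : ∀ j, Measurable fun z : Ω × (ℕ → I) ↦ ψ k (f i z.1 (z.2 j), z.2 j) := fun j ↦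
      hpath.comp (measurable_fst.prodMk ((measurable_pi_apply j).comp measurable_snd))
    have hN : ∀ N : ℕ, Measurable fun z : Ω × (ℕ → I) ↦
        (∑ j ∈ Finset.range N, ψ k (f i z.1 (z.2 j), z.2 j)) / N - ∫ t, ψ k (f i z.1 t, t) :=
      fun N ↦ ((Finset.measurable_sum _ fun j _ ↦ hm j).div_const _).sub (hL.comp measurable_fst)
    convert measurableSet_tendsto (𝓝 (0 : ℝ)) hN (l := atTop) using 2
    ext z
    exact tendsto_sub_nhds_zero_iff.symm
  -- Fubini: for almost every path, almost every sampling sequence works; hence almost every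
  -- sequence works for almost every path, and one sequence can be fixed for all `i` and `k`.
  refine (Measure.ae_ae_comm hset).1 ?_
  filter_upwards [hint i k] with ω hω
  exact ae_tendsto_average_sample (hpath.comp measurable_prodMk_left) hω

/-- Integrals along the paths are, almost surely, measurable functions of the family of values of
the process. -/
lemma exists_measurable_functional (hf_meas : ∀ i, Measurable (Function.uncurry (f i))) {κ : Type*}
    [Countable κ] {ψ : κ → ℝ × I → ℝ} (hψ : ∀ k, Measurable (ψ k))
    (hint : ∀ i k, ∀ᵐ ω ∂μ, Integrable fun t ↦ ψ k (f i ω t, t)) :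
    ∃ Ψ : κ → (I → ℝ) → ℝ, (∀ k, Measurable (Ψ k)) ∧
      ∀ i k, ∀ᵐ ω ∂μ, Ψ k (f i ω) = ∫ t, ψ k (f i ω t, t) := by
  obtain ⟨u, hu⟩ := exists_sampling_points hf_meas hψ hint
  -- The limsup in `EReal` is defined and measurable at every function `x`, whether or not the
  -- averages converge. The same functional serves every `i`, which lets independence and equality
  -- in law pass to the integrals.
  refine ⟨fun k x ↦ (limsup (fun N : ℕ ↦
    (((∑ j ∈ Finset.range N, ψ k (x (u j), u j)) / N : ℝ) : EReal)) atTop).toReal, fun k ↦ ?_,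
    fun i k ↦ ?_⟩
  · refine Measurable.ereal_toReal (Measurable.limsup fun N ↦ Measurable.coe_real_ereal ?_)
    refine (Finset.measurable_sum _ fun j _ ↦ ?_).div_const _
    exact (hψ k).comp ((measurable_pi_apply _).prodMk measurable_const)
  · filter_upwards [hu i k] with ω hω
    have := (EReal.tendsto_coe.2 hω).limsup_eq
    simp only [this, EReal.toReal_coe]

/-- Equality in law is used at each fixed `t`, where evaluation is measurable, and integrated over
`t` by Tonelli; the `L²` norm of a path need not be measurable for the product σ-algebra. -/
lemma ae_memLp_path (hf_meas : ∀ i, Measurable (Function.uncurry (f i)))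
    (hf_ident : ∀ i, IdentDistrib (f i) (f 0) μ μ)
    (hf_fourth : ∫⁻ ω, eLpNorm (f 0 ω) 2 volume ^ 4 ∂μ < ∞) (i : ℕ) :
    ∀ᵐ ω ∂μ, MemLp (f i ω) 2 := by
  have hsq : ∀ i, Measurable fun z : Ω × I ↦ ENNReal.ofReal (f i z.1 z.2 ^ 2) := fun i ↦
    ((hf_meas i).pow_const 2).ennreal_ofReal
  have hswap : ∀ i, ∫⁻ ω, (∫⁻ t, ENNReal.ofReal (f i ω t ^ 2)) ∂μ =
      ∫⁻ t, (∫⁻ ω, ENNReal.ofReal (f i ω t ^ 2) ∂μ) := fun i ↦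
    lintegral_lintegral_swap (hsq i).aemeasurable
  have hid : ∀ t, ∫⁻ ω, ENNReal.ofReal (f i ω t ^ 2) ∂μ = ∫⁻ ω, ENNReal.ofReal (f 0 ω t ^ 2) ∂μ :=
    fun t ↦ ((hf_ident i).comp (u := fun x : I → ℝ ↦ ENNReal.ofReal (x t ^ 2))
      ((measurable_pi_apply t).pow_const 2).ennreal_ofReal).lintegral_eq
  have hfin := second_moment_lt_top hf_fourth
  rw [hswap, ← lintegral_congr hid, ← hswap] at hfin
  filter_upwards [ae_lt_top (hsq i).lintegral_prod_right' hfin.ne] with ω hω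
  have hm : Measurable (f i ω) := (hf_meas i).of_uncurry_left
  rw [memLp_two_iff_integrable_sq hm.aestronglyMeasurable]
  refine ⟨(hm.pow_const 2).aestronglyMeasurable, ?_⟩
  rw [hasFiniteIntegral_iff_ofReal (Eventually.of_forall fun x ↦ sq_nonneg _)]
  exact hω

/-- The coefficients of `g` together with its squared norm. -/
noncomputable def statistics (phi : ℕ → I → ℝ) (g : I → ℝ) : (ℕ → ℝ) × ℝ :=
  (fun p ↦ coeff g (phi p), ∫ t, g t ^ 2)

lemma exists_measurable_statistics (hf_meas : ∀ i, Measurable (Function.uncurry (f i)))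
    (hf_L2 : ∀ i, ∀ᵐ ω ∂μ, MemLp (f i ω) 2) {phi : ℕ → I → ℝ} (hphi : ∀ p, MemLp (phi p) 2) :
    ∃ Φ : (I → ℝ) → (ℕ → ℝ) × ℝ, Measurable Φ ∧
      ∀ i, ∀ᵐ ω ∂μ, Φ (f i ω) = statistics phi (f i ω) := by
  set phi' : ℕ → I → ℝ := fun p ↦ (hphi p).1.mk (phi p) with hphi'
  have hm' : ∀ p, Measurable (phi' p) := fun p ↦ (hphi p).1.stronglyMeasurable_mk.measurable
  have hae : ∀ p, phi p =ᵐ[volume] phi' p := fun p ↦ (hphi p).1.ae_eq_mk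
  obtain ⟨Ψ, hΨ, hΨe⟩ := exists_measurable_functional (μ := μ) hf_meas
    (ψ := fun p z ↦ z.1 * phi' p z.2)
    (fun p ↦ measurable_fst.mul ((hm' p).comp measurable_snd)) (fun i p ↦ by
      filter_upwards [hf_L2 i] with ω hω
      exact hω.integrable_mul ((memLp_congr_ae (hae p)).1 (hphi p)))
  obtain ⟨Ψ', hΨ', hΨe'⟩ := exists_measurable_functional (μ := μ) hf_meas
    (ψ := fun (_ : Unit) z ↦ z.1 ^ 2) (fun _ ↦ measurable_fst.pow_const 2) (fun i _ ↦ by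
      filter_upwards [hf_L2 i] with ω hω
      exact (memLp_two_iff_integrable_sq hω.1).1 hω)
  refine ⟨fun x ↦ (fun p ↦ Ψ p x, Ψ' () x), (measurable_pi_lambda _ hΨ).prodMk (hΨ' ()),
    fun i ↦ ?_⟩
  filter_upwards [ae_all_iff.2 (hΨe i), hΨe' i ()] with ω h1 h2
  refine Prod.ext (funext fun p ↦ ?_) h2
  simp only [statistics, h1 p, coeff]
  exact integral_congr_ae ((hae p).mono fun t ht ↦ by simp [ht])

/-- The law of large numbers for events that depend on the coefficients and the norm of the
paths. -/
lemma tendstoInMeasure_average (hf_indep : iIndepFun f μ)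
    (hf_ident : ∀ i, IdentDistrib (f i) (f 0) μ μ) {phi : ℕ → I → ℝ}
    {Φ : (I → ℝ) → (ℕ → ℝ) × ℝ} (hΦ : Measurable Φ)
    (hΦe : ∀ i, ∀ᵐ ω ∂μ, Φ (f i ω) = statistics phi (f i ω)) {B : Set ((ℕ → ℝ) × ℝ)}
    (hB : MeasurableSet B) :
    TendstoInMeasure μ (fun (n : ℕ) ω ↦ (1 / (n : ℝ)) *
        ∑ i : Fin n, B.indicator 1 (statistics phi (f i ω))) atTop
      (fun _ ↦ μ.real {ω | statistics phi (f 0 ω) ∈ B}) := by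
  set J : (I → ℝ) → ℝ := fun x ↦ B.indicator 1 (Φ x) with hJ
  have hJm : Measurable J := (measurable_one.indicator hB).comp hΦ
  have hfm : ∀ i, AEMeasurable (f i) μ := fun i ↦ (hf_ident i).aemeasurable_fst
  have hint : Integrable (fun ω ↦ J (f 0 ω)) μ := by
    refine Integrable.of_bound (hJm.comp_aemeasurable (hfm 0)).aestronglyMeasurable 1
      (Eventually.of_forall fun ω ↦ ?_)
    simp only [hJ, Set.indicator]
    split_ifs <;> simp
  have hlln := strong_law_ae_real (fun i ω ↦ J (f i ω)) hint
    (fun i j hij ↦ (hf_indep.comp (fun _ ↦ J) (fun _ ↦ hJm)).indepFun hij)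
    (fun i ↦ (hf_ident i).comp hJm)
  have hE : ∫ ω, J (f 0 ω) ∂μ = μ.real {ω | statistics phi (f 0 ω) ∈ B} := by
    have h1 : (fun ω ↦ J (f 0 ω)) =
        ((fun ω ↦ Φ (f 0 ω)) ⁻¹' B).indicator 1 := by
      rfl
    have hnull : NullMeasurableSet ((fun ω ↦ Φ (f 0 ω)) ⁻¹' B) μ :=
      (hΦ.comp_aemeasurable (hfm 0)).nullMeasurableSet_preimage hB
    rw [h1, integral_indicator₀ hnull]
    simp only [Pi.one_apply, integral_const, smul_eq_mul, mul_one, measureReal_restrict_apply_univ]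
    refine measureReal_congr ?_
    filter_upwards [hΦe 0] with ω hω
    exact propext (by
      change Φ (f 0 ω) ∈ B ↔ statistics phi (f 0 ω) ∈ B
      rw [hω])
  rw [hE] at hlln
  refine TendstoInMeasure.congr_left (f := fun (n : ℕ) ω ↦ (1 / (n : ℝ)) *
    ∑ i : Fin n, J (f i ω)) (fun n ↦ ?_) (tendstoInMeasure_of_tendsto_ae (fun n ↦ ?_) ?_)
  · filter_upwards [ae_all_iff.2 hΦe] with ω hω
    simp only [hJ, hω]
  · refine AEMeasurable.aestronglyMeasurable ?_
    have h1 : ∀ i, AEMeasurable (fun ω ↦ J (f i ω)) μ := fun i ↦ hJm.comp_aemeasurable (hfm i)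
    fun_prop
  · filter_upwards [hlln] with ω hω
    refine hω.congr fun n ↦ ?_
    rw [Fin.sum_univ_eq_sum_range (fun i ↦ J (f i ω)), one_div_mul_eq_div]

end

/-! ### Bracketing the estimated norm. -/

/-- The squared weighted norm in terms of the coefficients. -/
noncomputable def coeffNormSq (lam w c : ℕ → ℝ) : ℝ≥0∞ :=
  ∑' p, ENNReal.ofReal (c p ^ 2 / lam p * w p ^ 2)

/-- An upper bound for the estimated squared norm. -/
noncomputable def upperBound (lam w : ℕ → ℝ) (η : ℝ) (z : (ℕ → ℝ) × ℝ) : ℝ≥0∞ :=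
  ENNReal.ofReal (1 + η) * coeffNormSq lam w z.1 + ENNReal.ofReal (η * z.2)

/-- A lower bound for the estimated squared norm. -/
noncomputable def lowerBound (lam w : ℕ → ℝ) (η : ℝ) (M : ℕ) (z : (ℕ → ℝ) × ℝ) : ℝ≥0∞ :=
  ENNReal.ofReal ((1 - η) * ∑ p ∈ Finset.range M, z.1 p ^ 2 / lam p * w p ^ 2 - η * z.2)

lemma measurable_coeffNormSq (lam w : ℕ → ℝ) : Measurable (coeffNormSq lam w) := by
  unfold coeffNormSq
  exact Measurable.tsum fun p ↦ by fun_prop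

lemma measurable_upperBound (lam w : ℕ → ℝ) (η : ℝ) : Measurable (upperBound lam w η) :=
  (((measurable_coeffNormSq lam w).comp measurable_fst).const_mul _).add
    (measurable_snd.const_mul η).ennreal_ofReal

lemma measurable_lowerBound (lam w : ℕ → ℝ) (η : ℝ) (M : ℕ) :
    Measurable (lowerBound lam w η M) := by
  unfold lowerBound
  fun_prop

section Limits

variable {lam w : ℕ → ℝ} {η : ℕ → ℝ}

lemma tendsto_upperBound (hη : Tendsto η atTop (𝓝 0)) (z : (ℕ → ℝ) × ℝ) :
    Tendsto (fun k ↦ upperBound lam w (η k) z) atTop (𝓝 (coeffNormSq lam w z.1)) := by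
  have h1 : Tendsto (fun k ↦ ENNReal.ofReal (1 + η k)) atTop (𝓝 1) := by
    simpa using ENNReal.tendsto_ofReal (hη.const_add 1)
  have h2 : Tendsto (fun k ↦ ENNReal.ofReal (η k * z.2)) atTop (𝓝 0) := by
    simpa using ENNReal.tendsto_ofReal (hη.mul_const z.2)
  simpa [upperBound] using
    (ENNReal.Tendsto.mul_const (b := coeffNormSq lam w z.1) h1 (Or.inl one_ne_zero)).add h2

/-- The index `k` drives both the tolerance and the truncation, so the bound increases to the full
norm even when that is infinite. -/
lemma tendsto_lowerBound (hlam : ∀ p, 0 ≤ lam p) (hη : Tendsto η atTop (𝓝 0))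
    (hη0 : ∀ k, 0 ≤ η k) (hη1 : ∀ k, η k ≤ 1) {z : (ℕ → ℝ) × ℝ} (hz : 0 ≤ z.2) :
    Tendsto (fun k ↦ lowerBound lam w (η k) k z) atTop (𝓝 (coeffNormSq lam w z.1)) := by
  have hterm : ∀ p, 0 ≤ z.1 p ^ 2 / lam p * w p ^ 2 := fun p ↦ by
    have := hlam p
    positivity
  have h1 : Tendsto (fun k ↦ ENNReal.ofReal (1 - η k)) atTop (𝓝 1) := by
    simpa using ENNReal.tendsto_ofReal (hη.const_sub 1)
  have h2 : Tendsto (fun k ↦ ENNReal.ofReal (η k * z.2)) atTop (𝓝 0) := by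
    simpa using ENNReal.tendsto_ofReal (hη.mul_const z.2)
  have h3 : Tendsto (fun k : ℕ ↦ ENNReal.ofReal (∑ p ∈ Finset.range k, z.1 p ^ 2 / lam p * w p ^ 2))
      atTop (𝓝 (coeffNormSq lam w z.1)) := by
    simp_rw [ENNReal.ofReal_sum_of_nonneg fun p _ ↦ hterm p]
    exact ENNReal.tendsto_nat_tsum _
  have h4 := ENNReal.Tendsto.sub
    (ENNReal.Tendsto.mul h1 (Or.inl one_ne_zero) h3 (Or.inr (by simp))) h2 (Or.inr (by simp))
  rw [one_mul, tsub_zero] at h4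
  refine h4.congr fun k ↦ ?_
  rw [lowerBound, ENNReal.ofReal_sub _ (mul_nonneg (hη0 k) hz),
    ENNReal.ofReal_mul (sub_nonneg.2 (hη1 k))]

end Limits

lemma integral_sq_eq_norm_sq {g : I → ℝ} (hg : MemLp g 2) : ∫ t, g t ^ 2 = ‖hg.toLp g‖ ^ 2 := by
  rw [← real_inner_self_eq_norm_sq, ← coeff_eq_inner hg hg, coeff]
  simp_rw [sq]

/-- The square of `hatNorm`. -/
noncomputable def hatNormSq {n : ℕ} (cut : Fin n → ℝ) (δ : ℝ) (lamHat : Fin n → ℝ)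
    (phiHat : Fin n → I → ℝ) (a : ℕ → ℝ) (g : I → ℝ) : ℝ :=
  ∑ p with δ ≤ cut p, coeff g (phiHat p) ^ 2 / lamHat p * a p ^ 2

/-- Deterministic comparison of the estimated norm with the true one. -/
theorem exists_hatNormSq_bounds {K : I → I → ℝ} {lam : ℕ → ℝ} {phi : ℕ → I → ℝ}
    (h : IsEigenDecomposition K lam phi) {β : ℝ} (h_decay : EigenvalueDecay lam β)
    {a : ℕ → ℝ} (ha : Summable fun p ↦ a p ^ 2) {η : ℝ} (hη : 0 < η) (hη1 : η ≤ 1) :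
    ∃ θ : ℝ, 0 < θ ∧ ∀ {n : ℕ} {L : I → I → ℝ} {lamHat : Fin n → ℝ} {phiHat : Fin n → I → ℝ}
      {D : ℝ}, 0 ≤ D → IsEigenDecomposition L lamHat phiHat →
      AEStronglyMeasurable (fun x : I × I ↦ L x.1 x.2 - K x.1 x.2) →
      ∫⁻ x : I × I, ENNReal.ofReal ((L x.1 x.2 - K x.1 x.2) ^ 2) ≤ ENNReal.ofReal (D ^ 2) →
      (∀ p : Fin n, |lamHat p - lam p| ≤ D) ∧
      ∀ (cut : Fin n → ℝ) (δ : ℝ) (M : ℕ), M ≤ n →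
        (∀ p, δ ≤ cut p → D * ((p : ℝ) + 1) ^ ((3 * β + 2) / 2) ≤ θ) →
        (∀ p : Fin n, (p : ℕ) < M → δ ≤ cut p) → ∀ g : I → ℝ, MemLp g 2 →
          ENNReal.ofReal (hatNormSq cut δ lamHat phiHat a g) ≤
            upperBound lam a η (statistics phi g) ∧
          lowerBound lam a η M (statistics phi g) ≤
            ENNReal.ofReal (hatNormSq cut δ lamHat phiHat a g) := by
  have hlam := h_decay.summable h.nonneg
  set A : ℝ := ∑' p, a p ^ 2 with hA
  have hA0 : 0 ≤ A := tsum_nonneg fun p ↦ sq_nonneg _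
  -- Scaling the tolerance by `1 + ∑ aₚ²` keeps the total additive error below `η ‖g‖²`, however
  -- many indices are selected.
  set q : ℝ := η / (1 + A) with hq
  have hq0 : 0 < q := by positivity
  have hqη : q ≤ η := div_le_self hη.le (by linarith)
  have hqA : q * A ≤ η := by
    rw [hq, div_mul_eq_mul_div, div_le_iff₀ (by positivity)]
    nlinarith
  have hsf := h.spectralForm hlam
  obtain ⟨θ, hθ, H⟩ := hsf.exists_tolerance h_decay hq0 (hqη.trans hη1)
  refine ⟨θ, hθ, fun {n L lamHat phiHat D} hD h' hmeas hLK ↦ ?_⟩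
  have hsum' : Summable lamHat := (hasSum_fintype _).summable
  have hsf' := h'.spectralForm hsum'
  have hform : ∀ u v : Lp ℝ 2 (volume : Measure I),
      |kernelForm L u v - kernelForm K u v| ≤ D * (‖u‖ * ‖v‖) := fun u v ↦
    abs_kernelForm_sub_le (h.integrable_and_hasSum hlam u v).1
      (h'.integrable_and_hasSum hsum' u v).1 hmeas hD hLK
  refine ⟨fun p ↦ hsf.abs_eigenvalue_sub_le hsf' hform p,
    fun cut δ M hM hsel hselM g hg ↦ ?_⟩
  set S : Finset (Fin n) := Finset.univ.filter fun p ↦ δ ≤ cut p with hS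
  have hterm : ∀ p, 0 ≤ coeff g (phi p) ^ 2 / lam p * a p ^ 2 := fun p ↦ by
    have := h.nonneg p
    positivity
  set r : ℝ := ∫ t, g t ^ 2 with hr
  have hr0 : 0 ≤ r := integral_nonneg fun t ↦ sq_nonneg _
  have hbd : ∀ p ∈ S,
      coeff g (phiHat p) ^ 2 / lamHat p ≤ (1 + q) * (coeff g (phi p) ^ 2 / lam p) + q * r ∧
      (1 - q) * (coeff g (phi p) ^ 2 / lam p) - q * r ≤ coeff g (phiHat p) ^ 2 / lamHat p :=
    fun p hp ↦ by
    rw [coeff_eq_inner hg (h'.memLp p), coeff_eq_inner hg (h.memLp p), hr,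
      integral_sq_eq_norm_sq hg]
    exact H hD hsf' hform p (hsel p (Finset.mem_filter.1 hp).2) (hg.toLp g)
  have hSval : ∀ (G : ℕ → ℝ), ∑ p ∈ S, G p = ∑ p ∈ S.map Fin.valEmbedding, G p := fun G ↦ by
    rw [Finset.sum_map]; rfl
  have hSA : ∑ p ∈ S, a p ^ 2 ≤ A := by
    rw [hSval fun p ↦ a p ^ 2]
    exact ha.sum_le_tsum _ fun p _ ↦ sq_nonneg _
  have hSA0 : 0 ≤ ∑ p ∈ S, a p ^ 2 := Finset.sum_nonneg fun p _ ↦ sq_nonneg _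
  have hqr : q * r * ∑ p ∈ S, a p ^ 2 ≤ η * r := by
    calc q * r * ∑ p ∈ S, a p ^ 2 ≤ q * r * A := by gcongr
      _ = q * A * r := by ring
      _ ≤ η * r := by gcongr
  set Y : ℝ := ∑ p ∈ S, coeff g (phi p) ^ 2 / lam p * a p ^ 2 with hY
  have hY0 : 0 ≤ Y := Finset.sum_nonneg fun p _ ↦ hterm p
  have hup : hatNormSq cut δ lamHat phiHat a g ≤ (1 + η) * Y + η * r := by
    calc hatNormSq cut δ lamHat phiHat a g
        ≤ ∑ p ∈ S, ((1 + q) * (coeff g (phi p) ^ 2 / lam p) + q * r) * a p ^ 2 :=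
          Finset.sum_le_sum fun p hp ↦ mul_le_mul_of_nonneg_right (hbd p hp).1 (sq_nonneg _)
      _ = (1 + q) * Y + q * r * ∑ p ∈ S, a p ^ 2 := by
          rw [hY, Finset.mul_sum, Finset.mul_sum, ← Finset.sum_add_distrib]
          exact Finset.sum_congr rfl fun p _ ↦ by ring
      _ ≤ _ := by gcongr
  have hlow : (1 - η) * Y - η * r ≤ hatNormSq cut δ lamHat phiHat a g := by
    calc (1 - η) * Y - η * r ≤ (1 - q) * Y - q * r * ∑ p ∈ S, a p ^ 2 := by gcongr
      _ = ∑ p ∈ S, ((1 - q) * (coeff g (phi p) ^ 2 / lam p) - q * r) * a p ^ 2 := by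
          rw [hY, Finset.mul_sum, Finset.mul_sum, ← Finset.sum_sub_distrib]
          exact Finset.sum_congr rfl fun p _ ↦ by ring
      _ ≤ hatNormSq cut δ lamHat phiHat a g :=
          Finset.sum_le_sum fun p hp ↦ mul_le_mul_of_nonneg_right (hbd p hp).2 (sq_nonneg _)
  constructor
  · refine (ENNReal.ofReal_le_ofReal hup).trans ?_
    rw [ENNReal.ofReal_add (by positivity) (by positivity), ENNReal.ofReal_mul (by positivity)]
    refine add_le_add (mul_le_mul_right ?_ _) le_rfl
    -- Above, the selected terms are part of the full series; below, they contain the first `M`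
    -- terms.
    rw [hY, hSval fun p ↦ coeff g (phi p) ^ 2 / lam p * a p ^ 2,
      ENNReal.ofReal_sum_of_nonneg fun p _ ↦ hterm p]
    exact ENNReal.sum_le_tsum _
  · refine ENNReal.ofReal_le_ofReal (le_trans ?_ hlow)
    refine sub_le_sub_right (mul_le_mul_of_nonneg_left ?_ (by linarith)) _
    rw [hY, hSval fun p ↦ coeff g (phi p) ^ 2 / lam p * a p ^ 2]
    refine Finset.sum_le_sum_of_subset_of_nonneg (fun p hp ↦ ?_) fun p _ _ ↦ hterm p
    have hpM := Finset.mem_range.1 hp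
    refine Finset.mem_map.2 ⟨⟨p, hpM.trans_le hM⟩, ?_, rfl⟩
    exact Finset.mem_filter.2 ⟨Finset.mem_univ _, hselM _ hpM⟩

/-! ### Consistency of the estimator. -/

section

variable {Ω : Type*} [MeasurableSpace Ω] {μ : Measure Ω}

/-- Two indicators that bracket the estimator squeeze it to the common limit of their means. -/
lemma tendstoInMeasure_of_bracket {E : ℕ → Ω → ℝ} {l : ℝ} {lo up : ℕ → ℕ → Ω → ℝ} {lo' up' : ℕ → ℝ}
    (hlo : ∀ k, TendstoInMeasure μ (lo k) atTop fun _ ↦ lo' k)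
    (hup : ∀ k, TendstoInMeasure μ (up k) atTop fun _ ↦ up' k)
    (hlo' : Tendsto lo' atTop (𝓝 l)) (hup' : Tendsto up' atTop (𝓝 l))
    {bad : ℕ → Set Ω} (hbad : Tendsto (fun n ↦ μ (bad n)) atTop (𝓝 0))
    (h : ∀ k, ∀ᶠ n in atTop, ∀ ω ∉ bad n, lo k n ω ≤ E n ω ∧ E n ω ≤ up k n ω) :
    TendstoInMeasure μ E atTop fun _ ↦ l := by
  rw [tendstoInMeasure_iff_norm]
  intro ε hε
  -- The bracket is fixed in terms of `ε` alone, before `n` tends to infinity.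
  obtain ⟨k, hk1, hk2⟩ := ((hlo'.eventually_const_lt (show l - ε / 2 < l by linarith)).and
    (hup'.eventually_lt_const (show l < l + ε / 2 by linarith))).exists
  have t1 := tendstoInMeasure_iff_norm.1 (hlo k) (ε / 2) (by positivity)
  have t2 := tendstoInMeasure_iff_norm.1 (hup k) (ε / 2) (by positivity)
  have t3 := hbad.add (t1.add t2)
  rw [add_zero, add_zero] at t3
  refine tendsto_of_tendsto_of_tendsto_of_le_of_le' tendsto_const_nhds t3
    (Eventually.of_forall fun _ ↦ zero_le) ?_
  filter_upwards [h k] with n hn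
  refine (measure_mono fun ω hω ↦ ?_).trans
    ((measure_union_le (bad n) _).trans (add_le_add_right (measure_union_le _ _) _))
  by_contra hcon
  rw [Set.mem_union, Set.mem_union, not_or, not_or, Set.mem_ofPred_eq, Set.mem_ofPred_eq, not_le,
    not_le, Real.norm_eq_abs, Real.norm_eq_abs, abs_lt, abs_lt] at hcon
  obtain ⟨hb, h1, h2⟩ := hcon
  have h3 := hn ω hb
  have h4 : ε ≤ |E n ω - l| := hω
  refine absurd h4 (not_le.2 (abs_lt.2 ⟨?_, ?_⟩)) <;> linarith

variable [IsProbabilityMeasure μ] {f : ℕ → Ω → I → ℝ}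

/-- Consistency of the estimator for any truncation rule at least as accurate as the estimated
eigenvalues. Square summability of the weights suffices. -/
theorem tendstoInMeasure_depthEstimator
    (hf_meas : ∀ i, Measurable (Function.uncurry (f i)))
    (hf_indep : iIndepFun f μ)
    (hf_ident : ∀ i, IdentDistrib (f i) (f 0) μ μ)
    (hf_second : ∀ t, MemLp (fun ω ↦ f 0 ω t) 2 μ)
    (hf_fourth : ∫⁻ ω, eLpNorm (f 0 ω) 2 volume ^ 4 ∂μ < ∞)
    {lam : ℕ → ℝ} {phi : ℕ → I → ℝ} (h_eig : IsEigenDecomposition (covKernel μ (f 0)) lam phi)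
    {a : ℕ → ℝ} {β : ℝ} (ha : Summable fun p ↦ a p ^ 2) (h_decay : EigenvalueDecay lam β)
    {δ : ℕ → ℝ} (hδ_lim : Tendsto δ atTop (𝓝 0))
    (hδ_rate : ∃ C : ℝ, 0 < C ∧ ∀ᶠ n : ℕ in atTop,
      C * (√n / Real.log n) ^ (-(β / (2 * β + 1))) ≤ δ n)
    {lamHat : (n : ℕ) → Ω → Fin n → ℝ} {phiHat : (n : ℕ) → Ω → Fin n → I → ℝ}
    (h_emp : ∀ n, ∀ᵐ ω ∂μ, IsEigenDecomposition
      (empKernel fun i : Fin n ↦ f i ω) (lamHat n ω) (phiHat n ω))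
    {cut : (n : ℕ) → Ω → Fin n → ℝ}
    (hcut : ∀ n ω p, |cut n ω p - lam p| ≤ |lamHat n ω p - lam p|)
    {fobs : I → ℝ} (h_obs : MemLp fobs 2)
    (h_cont : μ {ω | normSq lam phi a (f 0 ω) = normSq lam phi a fobs} = 0) :
    TendstoInMeasure μ
      (fun n ω ↦ depthEstimator (cut n ω) (δ n) (lamHat n ω) (phiHat n ω) a
        (fun i : Fin n ↦ f i ω) fobs)
      atTop (fun _ ↦ 1 - modCdf μ (f 0) lam phi a (normSq lam phi a fobs)) := by
  have hL2 := ae_memLp_path hf_meas hf_ident hf_fourth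
  obtain ⟨Φ, hΦ, hΦe⟩ := exists_measurable_statistics hf_meas hL2 h_eig.memLp
  have hstat : AEMeasurable (fun ω ↦ statistics phi (f 0 ω)) μ :=
    (hΦ.comp_aemeasurable (hf_ident 0).aemeasurable_fst).congr (hΦe 0)
  set zo := statistics phi fobs with hzo
  set x := normSq lam phi a fobs with hx
  have hxz : coeffNormSq lam a zo.1 = x := rfl
  set η : ℕ → ℝ := fun k ↦ 1 / ((k : ℝ) + 1) with hη
  have hη0 : ∀ k, 0 < η k := fun k ↦ by positivity
  have hη1 : ∀ k, η k ≤ 1 := fun k ↦ by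
    rw [hη]
    exact (div_le_one (by positivity)).2 (by linarith [k.cast_nonneg (α := ℝ)])
  have hηlim : Tendsto η atTop (𝓝 0) := tendsto_one_div_add_atTop_nhds_zero_nat
  -- On the good event, `lo k` implies the inequality between estimated norms, and that inequality
  -- implies `up k`. The bounds for the observation and for the sample path therefore enter with
  -- opposite roles.
  set up : ℕ → Set ((ℕ → ℝ) × ℝ) := fun k ↦
    {z | lowerBound lam a (η k) k zo ≤ upperBound lam a (η k) z} with hup
  set lo : ℕ → Set ((ℕ → ℝ) × ℝ) := fun k ↦
    {z | upperBound lam a (η k) zo ≤ lowerBound lam a (η k) k z} with hlo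
  have hupm : ∀ k, MeasurableSet (up k) := fun k ↦
    measurableSet_le measurable_const (measurable_upperBound _ _ _)
  have hlom : ∀ k, MeasurableSet (lo k) := fun k ↦
    measurableSet_le measurable_const (measurable_lowerBound _ _ _ _)
  set ν : Measure ((ℕ → ℝ) × ℝ) := μ.map fun ω ↦ statistics phi (f 0 ω) with hν
  have : IsProbabilityMeasure ν := Measure.isProbabilityMeasure_map hstat
  have hνr : ∀ B, MeasurableSet B → ν.real B = μ.real {ω | statistics phi (f 0 ω) ∈ B} :=
    fun B hB ↦ by
    rw [measureReal_def, hν, Measure.map_apply_of_aemeasurable hstat hB]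
    rfl
  have hcN : Measurable fun z : (ℕ → ℝ) × ℝ ↦ coeffNormSq lam a z.1 :=
    (measurable_coeffNormSq lam a).comp measurable_fst
  have hne : ∀ᵐ z ∂ν, coeffNormSq lam a z.1 ≠ x ∧ 0 ≤ z.2 := by
    have hms : MeasurableSet {z : (ℕ → ℝ) × ℝ | coeffNormSq lam a z.1 ≠ x ∧ 0 ≤ z.2} :=
      (hcN (measurableSet_singleton x)).compl.inter
        (measurableSet_le measurable_const measurable_snd)
    rw [hν, ae_map_iff hstat hms]
    have h1 : ∀ᵐ ω ∂μ, normSq lam phi a (f 0 ω) ≠ x := by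
      rw [ae_iff]
      simpa using h_cont
    filter_upwards [h1] with ω hω
    exact ⟨hω, integral_nonneg fun t ↦ sq_nonneg _⟩
  set A : Set ((ℕ → ℝ) × ℝ) := {z | x ≤ coeffNormSq lam a z.1} with hA
  have hAm : MeasurableSet A := measurableSet_le measurable_const hcN
  have hlimit : 1 - modCdf μ (f 0) lam phi a x = ν.real A := by
    have hBm : MeasurableSet {z : (ℕ → ℝ) × ℝ | coeffNormSq lam a z.1 ≤ x} :=
      measurableSet_le hcN measurable_const
    have h1 : modCdf μ (f 0) lam phi a x = ν.real {z | coeffNormSq lam a z.1 ≤ x} :=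
      (hνr _ hBm).symm
    rw [h1, ← probReal_compl_eq_one_sub hBm]
    refine measureReal_congr ?_
    filter_upwards [hne] with z hz
    refine propext ?_
    change ¬ (coeffNormSq lam a z.1 ≤ x) ↔ x ≤ coeffNormSq lam a z.1
    rw [not_le]
    exact ⟨le_of_lt, fun h ↦ lt_of_le_of_ne h hz.1.symm⟩
  rw [hlimit]
  have hzo2 : 0 ≤ zo.2 := integral_nonneg fun t ↦ sq_nonneg _
  have hU := fun z ↦ tendsto_upperBound (lam := lam) (w := a) hηlim z
  have hLw := fun {z : (ℕ → ℝ) × ℝ} (hz : 0 ≤ z.2) ↦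
    tendsto_lowerBound (w := a) h_eig.nonneg hηlim (fun k ↦ (hη0 k).le) hη1 hz
  -- Away from equality of the two norms the limiting inequality is strict, so membership in the
  -- approximating events is eventually constant. This is where the absence of a jump of `F` is
  -- needed.
  have hup_iff : ∀ᵐ z ∂ν, ∀ᶠ k in atTop, z ∈ up k ↔ z ∈ A := by
    filter_upwards [hne] with z ⟨hz, hz0⟩
    rcases lt_or_gt_of_ne hz with h | h
    · filter_upwards [(hU z).eventually_lt (hLw hzo2) h] with k hk
      exact iff_of_false (not_le.2 hk) (not_le.2 h)
    · filter_upwards [(hLw hzo2).eventually_lt (hU z) h] with k hk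
      exact iff_of_true hk.le h.le
  have hlo_iff : ∀ᵐ z ∂ν, ∀ᶠ k in atTop, z ∈ lo k ↔ z ∈ A := by
    filter_upwards [hne] with z ⟨hz, hz0⟩
    rcases lt_or_gt_of_ne hz with h | h
    · filter_upwards [(hLw hz0).eventually_lt (hU zo) h] with k hk
      exact iff_of_false (not_le.2 hk) (not_le.2 h)
    · filter_upwards [(hU zo).eventually_lt (hLw hz0) h] with k hk
      exact iff_of_true hk.le h.le
  have hlim : ∀ B : ℕ → Set ((ℕ → ℝ) × ℝ), (∀ k, MeasurableSet (B k)) →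
      (∀ᵐ z ∂ν, ∀ᶠ k in atTop, z ∈ B k ↔ z ∈ A) →
      Tendsto (fun k ↦ ν.real (B k)) atTop (𝓝 (ν.real A)) := fun B hB hBA ↦ by
    have := tendsto_measure_of_ae_tendsto_indicator atTop hAm hB MeasurableSet.univ
      (measure_ne_top ν _) (Eventually.of_forall fun k ↦ Set.subset_univ _) hBA
    exact (ENNReal.tendsto_toReal (measure_ne_top ν A)).comp this
  set far : ℕ → Set Ω := fun n ↦ {ω | ¬ ∫⁻ x : I × I, ENNReal.ofReal
      ((empKernel (fun i : Fin n ↦ f i ω) x.1 x.2 - covKernel μ (f 0) x.1 x.2) ^ 2) ≤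
        ENNReal.ofReal ((√n / Real.log n)⁻¹ ^ 2)} with hfar
  set irreg : ℕ → Set Ω := fun n ↦ {ω | ¬ ((∀ i, MemLp (f i ω) 2) ∧ IsEigenDecomposition
      (empKernel fun i : Fin n ↦ f i ω) (lamHat n ω) (phiHat n ω))} with hirreg
  have hirreg0 : ∀ n, μ (irreg n) = 0 := fun n ↦
    ae_iff.1 ((ae_all_iff.2 hL2).and (h_emp n))
  refine tendstoInMeasure_of_bracket (bad := fun n ↦ far n ∪ irreg n)
    (fun k ↦ tendstoInMeasure_average hf_indep hf_ident hΦ hΦe (hlom k))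
    (fun k ↦ tendstoInMeasure_average hf_indep hf_ident hΦ hΦe (hupm k)) ?_ ?_ ?_ fun k ↦ ?_
  · simp_rw [← fun k ↦ hνr _ (hlom k)]
    exact hlim lo hlom hlo_iff
  · simp_rw [← fun k ↦ hνr _ (hupm k)]
    exact hlim up hupm hup_iff
  · refine tendsto_of_tendsto_of_tendsto_of_le_of_le tendsto_const_nhds
      (tendsto_measure_empKernel_far hf_meas hf_indep hf_ident hf_second hf_fourth)
      (fun _ ↦ zero_le) fun n ↦ (measure_union_le _ _).trans ?_
    rw [hirreg0, add_zero]
  · obtain ⟨θ, hθ, H⟩ := exists_hatNormSq_bounds h_eig h_decay ha (hη0 k) (hη1 k)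
    filter_upwards [eventually_selection h_eig.antitone h_decay hδ_lim hδ_rate hθ k,
      eventually_ge_atTop k] with n hsel hkn
    intro ω hω
    rw [Set.mem_union, not_or] at hω
    have hfarω := not_not.1 hω.1
    obtain ⟨hmem, hdec⟩ := not_not.1 hω.2
    have hD : 0 ≤ (√(n : ℝ) / Real.log n)⁻¹ :=
      inv_nonneg.2 (div_nonneg (Real.sqrt_nonneg _) (Real.log_natCast_nonneg n))
    have hfm : ∀ i, Measurable (f i ω) := fun i ↦ (hf_meas i).of_uncurry_left
    have hmeas : AEStronglyMeasurable fun z : I × I ↦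
        empKernel (fun i : Fin n ↦ f i ω) z.1 z.2 - covKernel μ (f 0) z.1 z.2 := by
      refine Measurable.aestronglyMeasurable ?_
      have := measurable_covKernel (μ := μ) (hf_meas 0)
      simp only [empKernel, sampleMean]
      fun_prop
    obtain ⟨hW, hbounds⟩ := H hD hdec hmeas hfarω
    -- The cut sequence inherits the Weyl bound, so truncation by estimated and by true eigenvalues
    -- is handled by the same selection argument.
    have hcutD : ∀ p : Fin n, |cut n ω p - lam p| ≤ (√(n : ℝ) / Real.log n)⁻¹ := fun p ↦
      (hcut n ω p).trans (hW p)
    have hb := fun g hg ↦ hbounds (cut n ω) (δ n) k hkn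
      (fun p ↦ (hsel _ p (hcutD p)).1) (fun p ↦ (hsel _ p (hcutD p)).2) g hg
    have hsq0 : ∀ g, 0 ≤ hatNormSq (cut n ω) (δ n) (lamHat n ω) (phiHat n ω) a g := fun g ↦
      Finset.sum_nonneg fun p _ ↦ by
        have := hdec.nonneg p
        positivity
    have hiff : ∀ i, hatNorm (cut n ω) (δ n) (lamHat n ω) (phiHat n ω) a fobs ≤
        hatNorm (cut n ω) (δ n) (lamHat n ω) (phiHat n ω) a (f i ω) ↔
        ENNReal.ofReal (hatNormSq (cut n ω) (δ n) (lamHat n ω) (phiHat n ω) a fobs) ≤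
        ENNReal.ofReal (hatNormSq (cut n ω) (δ n) (lamHat n ω) (phiHat n ω) a (f i ω)) :=
      fun i ↦ (Real.sqrt_le_sqrt_iff (hsq0 _)).trans (ENNReal.ofReal_le_ofReal_iff (hsq0 _)).symm
    obtain ⟨hobs1, hobs2⟩ := hb fobs h_obs
    unfold depthEstimator
    constructor
    · refine mul_le_mul_of_nonneg_left (Finset.sum_le_sum fun i _ ↦ ?_) (by positivity)
      refine Set.indicator_apply_le' (fun hz ↦ ?_) fun _ ↦ by split_ifs <;> norm_num
      rw [if_pos ((hiff i).2 (hobs1.trans (le_trans hz (hb _ (hmem i)).2)))]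
      rfl
    · refine mul_le_mul_of_nonneg_left (Finset.sum_le_sum fun i _ ↦ ?_) (by positivity)
      split_ifs with hz
      · rw [Set.indicator_of_mem]
        · rfl
        · exact hobs2.trans (((hiff i).1 hz).trans (hb _ (hmem i)).1)
      · exact Set.indicator_nonneg (fun _ _ ↦ zero_le_one) _

end

end ModDepth

theorem theorem2
    {Ω : Type*} [MeasurableSpace Ω] (μ : Measure Ω) [IsProbabilityMeasure μ]
    -- an i.i.d. sequence of measurable second-order processes on `[0,1]`
    (f : ℕ → Ω → I → ℝ)
    (hf_meas : ∀ i, Measurable (Function.uncurry (f i)))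
    (hf_indep : iIndepFun f μ)
    (hf_ident : ∀ i, IdentDistrib (f i) (f 0) μ μ)
    (hf_second : ∀ t, MemLp (fun ω ↦ f 0 ω t) 2 μ)
    (hf_fourth : ∫⁻ ω, eLpNorm (f 0 ω) 2 volume ^ 4 ∂μ < ∞)
    -- the eigenvalues and eigenfunctions of the covariance kernel
    (lam : ℕ → ℝ) (phi : ℕ → I → ℝ)
    (h_eig : ModDepth.IsEigenDecomposition (ModDepth.covKernel μ (f 0)) lam phi)
    -- the weights and the three assumptions
    (a b : ℕ → ℝ) (β : ℝ)
    (ha : Summable fun p ↦ a p ^ 2)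
    (h_decay : ModDepth.EigenvalueDecay lam β)
    (h_weights : ModDepth.WeightDomination a b)
    (h_subG : ModDepth.SubGaussianNorm μ (f 0) lam phi b)
    -- the thresholds
    (δ : ℕ → ℝ) (hδ_lim : Tendsto δ atTop (𝓝 0))
    (hδ_rate : ∃ C : ℝ, 0 < C ∧ ∀ᶠ n : ℕ in atTop,
      C * (Real.sqrt n / Real.log n) ^ (-(β / (2 * β + 1))) ≤ δ n)
    -- any eigen-decompositions of the empirical covariance kernels
    (lamHat : (n : ℕ) → Ω → Fin n → ℝ) (phiHat : (n : ℕ) → Ω → Fin n → I → ℝ)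
    (h_emp : ∀ n, ∀ᵐ ω ∂μ, ModDepth.IsEigenDecomposition
      (ModDepth.empKernel fun i : Fin n ↦ f i ω) (lamHat n ω) (phiHat n ω))
    -- the observation, at which the distribution function `F` has no jump
    (fobs : I → ℝ) (h_obs : MemLp fobs 2)
    (h_cont : μ {ω | ModDepth.normSq lam phi a (f 0 ω) = ModDepth.normSq lam phi a fobs} = 0) :
    -- truncation by means of the estimated eigenvalues
    TendstoInMeasure μ
      (fun n ω ↦ ModDepth.depthEstimator (lamHat n ω) (δ n) (lamHat n ω) (phiHat n ω) a
        (fun i : Fin n ↦ f i ω) fobs)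
      atTop
      (fun _ ↦ 1 - ModDepth.modCdf μ (f 0) lam phi a (ModDepth.normSq lam phi a fobs)) ∧
    -- truncation by means of the true eigenvalues
    TendstoInMeasure μ
      (fun n ω ↦ ModDepth.depthEstimator (fun p : Fin n ↦ lam p) (δ n) (lamHat n ω) (phiHat n ω) a
        (fun i : Fin n ↦ f i ω) fobs)
      atTop
      (fun _ ↦ 1 - ModDepth.modCdf μ (f 0) lam phi a (ModDepth.normSq lam phi a fobs)) := by
  refine ⟨?_, ?_⟩
  · exact ModDepth.tendstoInMeasure_depthEstimator hf_meas hf_indep hf_ident hf_second hf_fourth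
      h_eig ha h_decay hδ_lim hδ_rate h_emp (fun n ω p ↦ le_rfl) h_obs h_cont
  · exact ModDepth.tendstoInMeasure_depthEstimator hf_meas hf_indep hf_ident hf_second hf_fourth
      h_eig ha h_decay hδ_lim hδ_rate h_emp
      (cut := fun n _ p ↦ lam p) (fun n ω p ↦ by simp) h_obs h_cont
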